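/- **Circuits.** A Boolean circuit with $n$ input bits is a finite directed acyclic graph of gates with one output gate; gates are inputs, constants, negations, and conjunctions and disjunctions of arbitrary fan-in. Its size is its number of gates, its depth the length of a longest directed path. $\mathrm{AC}^i$ is the class of languages $L\subseteq\{0,1\}^*$ decided by a (non-uniform) family $(C_n)_{n\in\mathbb N}$ of circuits, $C_n$ with $n$ input bits, of size $n^{O(1)}$ and depth $O((\log_2 n)^i)$. $\mathrm{NC}^i$ is defined in the same way with all gates of fan-in at most $2$. **Logic.** Let $\sigma$ be a finite relational vocabulary with at least one symbol of positive arity. A $\sigma$-structure with universe $\{0,\dots,n-1\}$ is encoded by the binary word that is the concatenation of the truth tables of its relations, each in lexicographic order. $\mathrm{FO}[\mathrm{Arb}]$ over $\sigma$ is first-order logic (with equality) over $\sigma$ and all numerical predicates; a $k$-ary numerical predicate is a family of arbitrary relations $P_n\subseteq\{0,\dots,n-1\}^k$, $n\in\mathbb N$, and is interpreted by $P_n$ in structures of size $n$. A tuple over $\{0,\dots,n-1\}$ is identified in comparisons with the number of which it is the base-$n$ representation, most significant digit first. Let $i\ge 0$. The formulas of $\mathrm{FO}[\mathrm{Arb}]+\mathrm{GPR}^i$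 over $\sigma$ are built by the rules of $\mathrm{FO}[\mathrm{Arb}]$ and the additional rule $$\varphi ::= [P(\overline x,\overline y_1,\dots,\overline y_{i+1})\equiv\theta(\overline x,\overline y_1,\dots,\overline y_{i+1},P)]\,\psi(P).$$ Here $P$ is a relation variable, $\overline y_1,\dots,\overline y_i$ are tuples of variables of the same positive length, $\overline x$ and $\overline y_{i+1}$ are tuples of variables of any lengths, $\theta$ and $\psi$ are $\mathrm{FO}[\mathrm{Arb}]$-formulas over $\sigma$ and $P$ in which $P$ does not occur in the scope of a negation, the free variables of $\theta$ are among $\overline x,\overline y_1,\dots,\overline y_{i+1}$, and each atom of $\theta$ that contains $P$ 1. is of the form $P(\overline x,\overline z_1,\dots,\overline z_{i+1})$, where $\overline z_1,\dots,\overline z_{i+1}$ are bound by a guarded quantification $$Q\,\overline z_1,\dots,\overline z_{i+1}.\Bigl(\bigvee_{j=1}^{i}\bigl(\overline y_j\neq 0\wedge\overline z_j\le\overline y_j/2\wedge\bigwedge_{k=1}^{j-1}\overline z_k\le\overline y_k\bigr)\wedge\xi(\overline y_1,\dots,\overline y_{i+1},\overline z_1,\dots,\overline z_{i+1})\Bigr),$$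 with $Q\in\{\forall,\exists\}$ and $\xi\in\mathrm{FO}[\mathrm{Arb}]$ containing no symbol of $\sigma$, and 2. does not occur in the scope of any quantification that is not guarded in this way. As usual, $(\exists\overline z.\alpha)\beta$ stands for $\exists\overline z(\alpha\wedge\beta)$ and $(\forall\overline z.\alpha)\beta$ for $\forall\overline z(\alpha\to\beta)$. The guards make the recursion well-founded, so in each structure there is exactly one relation $P$ such that $P(\overline a,\overline b)\leftrightarrow\theta(\overline a,\overline b,P)$ for all $\overline a,\overline b$; the formula $[P\equiv\theta]\psi(P)$ holds if and only if $\psi$ holds with this $P$. In $\mathrm{FO}[\mathrm{Arb}]+\mathrm{GPR}^i_{\mathrm{bound}}$ guarded quantifications are replaced by bounded ones: the quantified tuple $(\overline z_1,\dots,\overline z_{i+1})$ ranges only over the (at most) two lexicographically largest tuples that satisfy the relativizing formula in parentheses. A sentence over $\sigma$ defines the language of the encodings of its finite models. Each of these logics also denotes the class of all languages defined by its sentences, over any such $\sigma$. **Theorem.** 1. For every $i\ge 0$, $\mathrm{FO}[\mathrm{Arb}]+\mathrm{GPR}^i=\mathrm{AC}^i$. 2. For every $i\ge 1$, $\mathrm{FO}[\mathrm{Arb}]+\mathrm{GPR}^i_{\mathrm{bound}}=\mathrm{NC}^i$.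 Both equalities also hold if only sentences over the vocabulary of binary words are admitted, which has a single, unary relation symbol (a word of length $n$ being the structure with universe $\{0,\dots,n-1\}$ in which this relation is the set of positions of the letter $1$). -/

import Mathlib

open Asymptotics Filter

namespace CircuitLogic

/-! ## Boolean circuits and the non-uniform classes AC^i and NC^i -/

/-- The label of a gate of a Boolean circuit with `n` input bits and set of gates `G`, together
with its immediate predecessors.  Conjunctions and disjunctions have arbitrary fan-in. -/
inductive Node (n : ℕ) (G : Type) : Type
  | input (j : Fin n)
  | const (b : Bool)
  | not (u : G)
  | and (us : Finset G)
  | or (us : Finset G)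

/-- The immediate predecessors of a gate. -/
def Node.preds {n : ℕ} {G : Type} : Node n G → Finset G
  | .input _ => ∅
  | .const _ => ∅
  | .not u => {u}
  | .and us => us
  | .or us => us

/-- The value of a gate on the input word `x`, given the values of its predecessors. -/
def Node.sem {n : ℕ} {G : Type} (x : Fin n → Bool) :
    (a : Node n G) → ((u : G) → u ∈ a.preds → Prop) → Prop
  | .input j, _ => x j = true
  | .const b, _ => b = true
  | .not u, v => ¬ v u (Finset.mem_singleton_self u)
  | .and us, v => ∀ (u : G) (h : u ∈ us), v u h
  | .or us, v => ∃ (u : G) (h : u ∈ us), v u h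

/-- A Boolean circuit with `n` input bits: a finite directed acyclic graph of labelled gates, with
one output gate. -/
structure Circuit (n : ℕ) where
  /-- the gates -/
  G : Type
  [fin : Fintype G]
  /-- labels and wires -/
  node : G → Node n G
  /-- the output gate -/
  out : G
  /-- the graph has no directed cycle (equivalently, as it is finite, its edge relation is
  well-founded) -/
  acyclic : WellFounded fun u g : G => u ∈ (node g).preds

namespace Circuit

variable {n : ℕ}

/-- The number of gates. -/
def size (C : Circuit n) : ℕ := @Fintype.card C.G C.fin

/-- The truth value computed at a gate on input `x`. -/
def value (C : Circuit n) (x : Fin n → Bool) : C.G → Prop :=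
  C.acyclic.fix fun g ih => (C.node g).sem x ih

theorem value_eq (C : Circuit n) (x : Fin n → Bool) (g : C.G) :
    C.value x g = (C.node g).sem x fun u _ => C.value x u :=
  C.acyclic.fix_eq _ g

/-- The circuit accepts `x` if its output gate evaluates to true. -/
def Accepts (C : Circuit n) (x : Fin n → Bool) : Prop := C.value x C.out

/-- The length of a longest directed path that ends in a given gate. -/
def gateDepth (C : Circuit n) : C.G → ℕ :=
  C.acyclic.fix fun g ih => (C.node g).preds.attach.sup fun u => ih u.1 u.2 + 1

theorem gateDepth_eq (C : Circuit n) (g : C.G) :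
    C.gateDepth g = (C.node g).preds.sup fun u => C.gateDepth u + 1 := by
  rw [gateDepth, WellFounded.fix_eq]
  exact Finset.sup_attach (C.node g).preds fun u => C.gateDepth u + 1

/-- The depth of a circuit: the length of a longest directed path in it. -/
def depth (C : Circuit n) : ℕ := (@Finset.univ C.G C.fin).sup C.gateDepth

/-- Every gate has at most two predecessors. -/
def FanInTwo (C : Circuit n) : Prop := ∀ g : C.G, (C.node g).preds.card ≤ 2

end Circuit

/-- The language `L` of binary words is decided by the circuit family `C`. -/
def Decides (C : ∀ n : ℕ, Circuit n) (L : Set (List Bool)) : Prop :=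
  ∀ w : List Bool, w ∈ L ↔ (C w.length).Accepts w.get

/-- The family has size `n ^ O(1)`. -/
def PolySize (C : ∀ n : ℕ, Circuit n) : Prop :=
  ∃ k : ℕ, (fun n : ℕ => ((C n).size : ℝ)) =O[atTop] fun n : ℕ => (n : ℝ) ^ k

/-- The family has depth `O((log₂ n) ^ i)`. -/
def PolylogDepth (i : ℕ) (C : ∀ n : ℕ, Circuit n) : Prop :=
  (fun n : ℕ => ((C n).depth : ℝ)) =O[atTop] fun n : ℕ => (Real.logb 2 (n : ℝ)) ^ i

/-- Non-uniform `AC^i`. -/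
def AC (i : ℕ) : Set (Set (List Bool)) :=
  {L | ∃ C : ∀ n : ℕ, Circuit n, PolySize C ∧ PolylogDepth i C ∧ Decides C L}

/-- Non-uniform `NC^i`. -/
def NC (i : ℕ) : Set (Set (List Bool)) :=
  {L | ∃ C : ∀ n : ℕ, Circuit n,
    PolySize C ∧ PolylogDepth i C ∧ (∀ n : ℕ, (C n).FanInTwo) ∧ Decides C L}

/-! ## Finite structures, their encodings, and FO[Arb] -/

/-- A finite relational vocabulary, with its symbols listed in order.  At least one symbol has
positive arity, so that the encoding of a structure determines the size of its universe. -/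
structure Vocabulary where
  /-- the number of relation symbols -/
  card : ℕ
  /-- their arities -/
  arity : Fin card → ℕ
  exists_pos : ∃ r : Fin card, 0 < arity r

/-- The vocabulary of binary words: one unary predicate ("the bit at this position is 1"). -/
def wordVocabulary : Vocabulary where
  card := 1
  arity := fun _ => 1
  exists_pos := ⟨0, Nat.one_pos⟩

/-- A structure with universe `{0, ..., n - 1}`. -/
def Struct (σ : Vocabulary) (n : ℕ) : Type :=
  (r : Fin σ.card) → (Fin (σ.arity r) → Fin n) → Bool

/-- The `l`-th `k`-tuple over `{0, ..., n - 1}` in lexicographic order. -/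
def lexTuple (n k : ℕ) (l : Fin (n ^ k)) : Fin k → Fin n :=
  fun t => finFunctionFinEquiv.symm l t.rev

/-- The standard binary encoding of a structure: the concatenation of the truth tables of its
relations, each listed in lexicographic order. -/
def Struct.encode {σ : Vocabulary} {n : ℕ} (A : Struct σ n) : List Bool :=
  (List.finRange σ.card).flatMap fun r => List.ofFn fun l => A r (lexTuple n (σ.arity r) l)

/-- A `k`-ary numerical predicate: for each size `n`, an arbitrary relation on
`{0, ..., n - 1}`. -/
def NumPred (k : ℕ) : Type := ∀ n : ℕ, (Fin k → Fin n) → Prop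

/-- The relation symbols of FO[Arb] over `σ`: those of `σ` and all numerical predicates. -/
inductive RelSymbol (σ : Vocabulary) : ℕ → Type
  | input (r : Fin σ.card) : RelSymbol σ (σ.arity r)
  | numerical {k : ℕ} (P : NumPred k) : RelSymbol σ k

/-- The first-order language of FO[Arb] over `σ`. -/
def arbLanguage (σ : Vocabulary) : FirstOrder.Language.{0, 0} where
  Functions := fun _ => Empty
  Relations := RelSymbol σ

/-- The language of numerical predicates only, without the relations of the input structure. -/
def numLanguage : FirstOrder.Language.{0, 0} where
  Functions := fun _ => Empty
  Relations := NumPred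

instance numStructure (n : ℕ) : numLanguage.Structure (Fin n) where
  funMap := fun f _ => Empty.elim f
  RelMap := fun P v => P n v

/-- The interpretation of a relation symbol of FO[Arb] in a structure. -/
def Struct.interp {σ : Vocabulary} {n : ℕ} (A : Struct σ n) :
    {k : ℕ} → RelSymbol σ k → (Fin k → Fin n) → Prop
  | _, .input r, v => A r v = true
  | _, .numerical P, v => P n v

/-- A structure as a structure for the language of FO[Arb]. -/
abbrev Struct.toStructure {σ : Vocabulary} {n : ℕ} (A : Struct σ n) :
    (arbLanguage σ).Structure (Fin n) where
  funMap := fun f _ => Empty.elim f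
  RelMap := fun R v => A.interp R v

/-! ## Guarded predicative recursion

The recursion variables are the blocks `y_1, ..., y_i`, each consisting of `m` variables, and the
block `y_{i+1}`, consisting of `q` variables. -/

/-- The numerical interpretation of a tuple: a number in base `n`, most significant digit first. -/
def tupleValue {n m : ℕ} (t : Fin m → Fin n) : ℕ := ∑ k : Fin m, (t k : ℕ) * n ^ (k.rev : ℕ)

/-- The variables in the blocks `y_1, ..., y_i` and `y_{i+1}`. -/
abbrev RecVar (i m q : ℕ) : Type := (Fin i × Fin m) ⊕ Fin q

/-- Values in `{0, ..., n - 1}` for the variables in `y_1, ..., y_i, y_{i+1}`. -/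
abbrev RecTuple (i m q n : ℕ) : Type := RecVar i m q → Fin n

section Guard

variable {i m q n : ℕ}

/-- The numerical interpretation of the block `y_j` for `j ≤ i`. -/
def blockValue (y : RecTuple i m q n) (j : Fin i) : ℕ := tupleValue fun k => y (Sum.inl (j, k))

/-- The numerical interpretation of the block `y_{i+1}`. -/
def lastValue (y : RecTuple i m q n) : ℕ := tupleValue fun k => y (Sum.inr k)

/-- The recursion guard: some block `j` is properly halved (`y_j ≠ 0` and `z_j ≤ y_j / 2`) and no
earlier block increases. -/
def Guard (y z : RecTuple i m q n) : Prop :=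
  ∃ j : Fin i, (0 < blockValue y j ∧ 2 * blockValue z j ≤ blockValue y j) ∧
    ∀ k : Fin i, k < j → blockValue z k ≤ blockValue y k

/-- The lexicographic order on tuples. -/
def LexLT (z u : RecTuple i m q n) : Prop :=
  (∃ j : Fin i, blockValue z j < blockValue u j ∧
      ∀ k : Fin i, k < j → blockValue z k = blockValue u k) ∨
    ((∀ j : Fin i, blockValue z j = blockValue u j) ∧ lastValue z < lastValue u)

end Guard

/-- The two kinds of guarded quantification: over all tuples satisfying the guard, or only over the
two lexicographically largest ones. -/
inductive Mode : Type
  | unbounded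
  | bounded

/-- The tuples `z` over which a quantification relativized to `R` ranges.  In the bounded case these
are the elements of `R` above which `R` has at most one element. -/
def Mode.Range {i m q n : ℕ} : Mode → (RecTuple i m q n → Prop) → RecTuple i m q n → Prop
  | .unbounded, R, z => R z
  | .bounded, R, z => R z ∧ ∀ u v : RecTuple i m q n, u ≠ v → LexLT z u → LexLT z v → ¬ R u ∨ ¬ R v

/-- The bodies `θ(x, y_1, ..., y_{i+1}, P)` of guarded predicative recursions, inside of `d` guarded
quantifications.  Besides the `p` variables `x` and the variables `y`, such a formula may use the
variables of the `d` tuples bound by these quantifications.  The relation variable `P` occurs only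
positively, only in atoms `P(x, z)` where `z` is one of these tuples, and in the scope of guarded
quantifications only.  The additional condition `ξ(y, z)` in a guard does not mention the relations
of the input structure. -/
inductive Body (σ : Vocabulary) (p i m q : ℕ) : ℕ → Type
  /-- a first-order formula without `P` -/
  | fo {d : ℕ} (φ : (arbLanguage σ).Formula (Fin p ⊕ RecVar i m q ⊕ Fin d × RecVar i m q)) :
      Body σ p i m q d
  | and {d : ℕ} (θ₁ θ₂ : Body σ p i m q d) : Body σ p i m q d
  | or {d : ℕ} (θ₁ θ₂ : Body σ p i m q d) : Body σ p i m q d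
  /-- the atom `P(x, z)`, where `z` is bound by the `t`-th enclosing guarded quantification -/
  | call {d : ℕ} (t : Fin d) : Body σ p i m q d
  /-- `∀ z.(Guard(y, z) ∧ ξ(y, z)) θ` -/
  | all {d : ℕ} (ξ : numLanguage.Formula (RecVar i m q ⊕ RecVar i m q))
      (θ : Body σ p i m q (d + 1)) : Body σ p i m q d
  /-- `∃ z.(Guard(y, z) ∧ ξ(y, z)) θ` -/
  | ex {d : ℕ} (ξ : numLanguage.Formula (RecVar i m q ⊕ RecVar i m q))
      (θ : Body σ p i m q (d + 1)) : Body σ p i m q d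

/-- The tuples `z` with `Guard(y, z) ∧ ξ(y, z)`. -/
def GuardSet {i m q n : ℕ} (ξ : numLanguage.Formula (RecVar i m q ⊕ RecVar i m q))
    (y z : RecTuple i m q n) : Prop :=
  Guard y z ∧ ξ.Realize (Sum.elim y z)

/-- Satisfaction of `θ(x, y, P)`, where `c` gives the values of the tuples that are bound by the
enclosing guarded quantifications. -/
def Body.Realize {σ : Vocabulary} {p i m q n : ℕ} (b : Mode) (A : Struct σ n)
    (P : (Fin p → Fin n) → RecTuple i m q n → Prop) (x : Fin p → Fin n) (y : RecTuple i m q n) :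
    {d : ℕ} → Body σ p i m q d → (Fin d → RecTuple i m q n) → Prop
  | _, .fo φ, c =>
      letI := A.toStructure
      φ.Realize (Sum.elim x (Sum.elim y fun tv => c tv.1 tv.2))
  | _, .and θ₁ θ₂, c => θ₁.Realize b A P x y c ∧ θ₂.Realize b A P x y c
  | _, .or θ₁ θ₂, c => θ₁.Realize b A P x y c ∨ θ₂.Realize b A P x y c
  | _, .call t, c => P x (c t)
  | _, .all ξ θ, c => ∀ z, b.Range (GuardSet ξ y) z → θ.Realize b A P x y (Fin.snoc c z)
  | _, .ex ξ θ, c => ∃ z, b.Range (GuardSet ξ y) z ∧ θ.Realize b A P x y (Fin.snoc c z)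

/-- `P` satisfies the recursion: `P(x, y) ↔ θ(x, y, P)` for all `x` and `y`. -/
def Body.Defines {σ : Vocabulary} {p i m q n : ℕ} (b : Mode) (A : Struct σ n)
    (θ : Body σ p i m q 0) (P : (Fin p → Fin n) → RecTuple i m q n → Prop) : Prop :=
  ∀ (x : Fin p → Fin n) (y : RecTuple i m q n), P x y ↔ θ.Realize b A P x y Fin.elim0

theorem Guard.wellFounded (i m q n : ℕ) :
    WellFounded fun z y : RecTuple i m q n => Guard y z := by
  have h : WellFounded fun z y : RecTuple i m q n =>
      toLex (blockValue z) < toLex (blockValue y) :=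
    InvImage.wf (fun y : RecTuple i m q n => toLex (blockValue y)) wellFounded_lt
  refine Subrelation.wf (fun {z y} hzy => ?_) h
  obtain ⟨j, ⟨h0, h2⟩, hk⟩ := hzy
  by_contra hn
  rcases (not_lt.1 hn).eq_or_lt with he | ⟨k, heq, hlt⟩
  · have := congrFun (toLex.injective he) j
    omega
  · simp only [Pi.toLex_apply] at heq hlt
    rcases lt_trichotomy k j with hkj | rfl | hjk
    · have := hk k hkj
      omega
    · omega
    · have := heq j hjk
      omega

theorem Mode.Range.of_mem {i m q n : ℕ} {b : Mode} {R : RecTuple i m q n → Prop}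
    {z : RecTuple i m q n} (h : b.Range R z) : R z := by
  cases b
  · exact h
  · exact h.1

theorem Body.realize_congr {σ : Vocabulary} {p i m q n : ℕ} {b : Mode} {A : Struct σ n}
    {P Q : (Fin p → Fin n) → RecTuple i m q n → Prop} {x : Fin p → Fin n} {y : RecTuple i m q n}
    (h : ∀ z, Guard y z → (P x z ↔ Q x z)) {d : ℕ} (θ : Body σ p i m q d) :
    ∀ c : Fin d → RecTuple i m q n, (∀ t, Guard y (c t)) →
      (θ.Realize b A P x y c ↔ θ.Realize b A Q x y c) := by
  have hsnoc : ∀ {d : ℕ} (c : Fin d → RecTuple i m q n) (z : RecTuple i m q n),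
      (∀ t, Guard y (c t)) → Guard y z →
        ∀ t, Guard y ((Fin.snoc c z : Fin (d + 1) → RecTuple i m q n) t) := by
    intro d c z hc hz t
    refine Fin.lastCases ?_ (fun t => ?_) t
    · simpa using hz
    · simpa using hc t
  induction θ with
  | fo φ => exact fun c _ => Iff.rfl
  | and θ₁ θ₂ ih₁ ih₂ => exact fun c hc => and_congr (ih₁ c hc) (ih₂ c hc)
  | or θ₁ θ₂ ih₁ ih₂ => exact fun c hc => or_congr (ih₁ c hc) (ih₂ c hc)
  | call t => exact fun c hc => h _ (hc t)
  | all ξ θ ih =>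
    exact fun c hc => forall_congr' fun z => imp_congr_right fun hz =>
      ih _ (hsnoc c z hc hz.of_mem.1)
  | ex ξ θ ih =>
    exact fun c hc => exists_congr fun z => and_congr_right fun hz =>
      ih _ (hsnoc c z hc hz.of_mem.1)

/-- A guarded predicative recursion defines exactly one relation. -/
theorem Body.existsUnique_defines {σ : Vocabulary} {p i m q n : ℕ} (b : Mode) (A : Struct σ n)
    (θ : Body σ p i m q 0) : ∃! P, θ.Defines b A P := by
  let P : (Fin p → Fin n) → RecTuple i m q n → Prop := fun x =>
    (Guard.wellFounded i m q n).fix fun y ih =>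
      θ.Realize b A (fun _ z => ∃ h : Guard y z, ih z h) x y Fin.elim0
  have hP : θ.Defines b A P := by
    intro x y
    have e : P x y = θ.Realize b A (fun _ z => ∃ _ : Guard y z, P x z) x y Fin.elim0 :=
      (Guard.wellFounded i m q n).fix_eq _ y
    rw [e]
    exact θ.realize_congr (fun z hz => ⟨fun h => h.2, fun h => ⟨hz, h⟩⟩) _ fun t => t.elim0
  refine ⟨P, hP, fun Q hQ => ?_⟩
  funext x y
  induction y using (Guard.wellFounded i m q n).induction with
  | _ y ih =>
    refine propext ((hQ x y).trans (Iff.trans ?_ (hP x y).symm))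
    exact θ.realize_congr (fun z hz => by rw [ih z hz]) _ fun t => t.elim0

/-- First-order formulas `ψ(P)` with `d` variables in which the relation variable `P` occurs
positively. -/
inductive PosFormula (σ : Vocabulary) (p i m q : ℕ) : ℕ → Type
  /-- a first-order formula without `P` -/
  | fo {d : ℕ} (φ : (arbLanguage σ).Formula (Fin d)) : PosFormula σ p i m q d
  /-- an atom `P(v, w)` -/
  | atom {d : ℕ} (v : Fin p → Fin d) (w : RecVar i m q → Fin d) : PosFormula σ p i m q d
  | and {d : ℕ} (ψ₁ ψ₂ : PosFormula σ p i m q d) : PosFormula σ p i m q d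
  | or {d : ℕ} (ψ₁ ψ₂ : PosFormula σ p i m q d) : PosFormula σ p i m q d
  | all {d : ℕ} (ψ : PosFormula σ p i m q (d + 1)) : PosFormula σ p i m q d
  | ex {d : ℕ} (ψ : PosFormula σ p i m q (d + 1)) : PosFormula σ p i m q d

/-- Satisfaction of `ψ(P)` under the assignment `s`. -/
def PosFormula.Realize {σ : Vocabulary} {p i m q n : ℕ} (A : Struct σ n)
    (P : (Fin p → Fin n) → RecTuple i m q n → Prop) :
    {d : ℕ} → PosFormula σ p i m q d → (Fin d → Fin n) → Prop
  | _, .fo φ, s =>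
      letI := A.toStructure
      φ.Realize s
  | _, .atom v w, s => P (s ∘ v) (s ∘ w)
  | _, .and ψ₁ ψ₂, s => ψ₁.Realize A P s ∧ ψ₂.Realize A P s
  | _, .or ψ₁ ψ₂, s => ψ₁.Realize A P s ∨ ψ₂.Realize A P s
  | _, .all ψ, s => ∀ a : Fin n, ψ.Realize A P (Fin.snoc s a)
  | _, .ex ψ, s => ∃ a : Fin n, ψ.Realize A P (Fin.snoc s a)

/-- The formulas of FO[Arb] + GPR^i over `σ` with `d` variables: first-order logic extended by the
rule `[P(x, y_1, ..., y_{i+1}) ≡ θ(x, y_1, ..., y_{i+1}, P)] ψ(P)`. -/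
inductive GPRFormula (σ : Vocabulary) (i : ℕ) : ℕ → Type
  /-- a first-order formula -/
  | fo {d : ℕ} (φ : (arbLanguage σ).Formula (Fin d)) : GPRFormula σ i d
  | not {d : ℕ} (φ : GPRFormula σ i d) : GPRFormula σ i d
  | and {d : ℕ} (φ₁ φ₂ : GPRFormula σ i d) : GPRFormula σ i d
  | or {d : ℕ} (φ₁ φ₂ : GPRFormula σ i d) : GPRFormula σ i d
  | all {d : ℕ} (φ : GPRFormula σ i (d + 1)) : GPRFormula σ i d
  | ex {d : ℕ} (φ : GPRFormula σ i (d + 1)) : GPRFormula σ i d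
  /-- guarded predicative recursion, where `x` consists of `p` variables, each of `y_1, ..., y_i`
  of `m > 0` variables, and `y_{i+1}` of `q` variables -/
  | gpr {d : ℕ} (p m q : ℕ) (hm : 0 < m) (θ : Body σ p i m q 0) (ψ : PosFormula σ p i m q d) :
      GPRFormula σ i d

/-- Satisfaction for FO[Arb] + GPR^i, with guarded quantification of the given kind. -/
def GPRFormula.Realize {σ : Vocabulary} {i n : ℕ} (b : Mode) (A : Struct σ n) :
    {d : ℕ} → GPRFormula σ i d → (Fin d → Fin n) → Prop
  | _, .fo φ, s =>
      letI := A.toStructure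
      φ.Realize s
  | _, .not φ, s => ¬ φ.Realize b A s
  | _, .and φ₁ φ₂, s => φ₁.Realize b A s ∧ φ₂.Realize b A s
  | _, .or φ₁ φ₂, s => φ₁.Realize b A s ∨ φ₂.Realize b A s
  | _, .all φ, s => ∀ a : Fin n, φ.Realize b A (Fin.snoc s a)
  | _, .ex φ, s => ∃ a : Fin n, φ.Realize b A (Fin.snoc s a)
  | _, .gpr _ _ _ _ θ ψ, s => ∃ P, θ.Defines b A P ∧ ψ.Realize A P s

/-- The language defined by a sentence over `σ`: the set of encodings of its finite models. -/
def GPRFormula.language {σ : Vocabulary} {i : ℕ} (b : Mode) (φ : GPRFormula σ i 0) :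
    Set (List Bool) :=
  {w | ∃ (n : ℕ) (A : Struct σ n), w = A.encode ∧ φ.Realize b A Fin.elim0}

/-- The languages definable by sentences over a fixed vocabulary. -/
def definableOver (σ : Vocabulary) (b : Mode) (i : ℕ) : Set (Set (List Bool)) :=
  {L | ∃ φ : GPRFormula σ i 0, L = φ.language b}

/-- The class FO[Arb] + GPR^i. -/
def FOArbGPR (i : ℕ) : Set (Set (List Bool)) :=
  {L | ∃ σ : Vocabulary, L ∈ definableOver σ .unbounded i}

/-- The class FO[Arb] + GPR^i_bound. -/
def FOArbGPRBound (i : ℕ) : Set (Set (List Bool)) :=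
  {L | ∃ σ : Vocabulary, L ∈ definableOver σ .bounded i}

end CircuitLogic

/-! Both equalities are proved at once, with the mode `b` fixing the kind of guarded quantification
and the fan-in.

From logic to circuits: a formula is computed for all assignments simultaneously, with polynomially
many gates. Each connective or quantifier adds boundedly many layers; under fan-in two a first-order
quantifier becomes a binary tree of logarithmic depth, which is where `1 ≤ i` is needed. For a
recursion, consider the bit lengths of the first `i` blocks of `y`. A guarded step decreases this
vector lexicographically (`exists_guard_rank`), so `O(log^i n)` rounds, started from the empty
relation, reach the relation being defined. One round costs only constant depth (`derives_body`):
the first-order parts of `θ` do not mention `P` and are computed once in advance, and the range of a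
guarded quantification depends on `n` and `y` but not on the input, so the quantification is a
single gate, with at most two predecessors in bounded mode. Every word of the right length encodes
exactly one structure (`encode_structAt`), so input gates can read its atomic facts.

From circuits to logic: `P` occurs only positively, so each gate gets two tuples, asserting that it
is true and that it is false (`Node.eval_iff_rail`). The depth of a gate is written with `i` digits
in a base `B = O(log n)`, and a digit `d` is stored as the block value `2 ^ d - 1`; a
lexicographically smaller code then satisfies the guard (`exists_halving_code`), so wires are
guarded steps. The circuit itself is supplied by numerical predicates. For `i = 0` the guard is
unsatisfiable, but then the depth is constant and the evaluation unfolds into a first-order formula.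

The resulting sentences use only the vocabulary of words, so the two inclusions give the equalities
both for this vocabulary and for the union over all vocabularies. -/

namespace CircuitLogic

/-! ## A calculus of multi-output circuits -/

namespace Node

variable {n : ℕ} {G H : Type}

/-- The value of a gate in terms of a valuation of all gates. -/
def eval (x : Fin n → Bool) (a : Node n G) (v : G → Prop) : Prop := a.sem x fun u _ => v u

open Classical in
/-- Renaming of the predecessors of a gate. -/
noncomputable def map (f : G → H) : Node n G → Node n H
  | .input j => .input j
  | .const b => .const b
  | .not u => .not (f u)
  | .and us => .and (us.image f)
  | .or us => .or (us.image f)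

theorem eval_map (x : Fin n → Bool) (f : G → H) (a : Node n G) (v : H → Prop) :
    (a.map f).eval x v ↔ a.eval x (v ∘ f) := by
  cases a <;> simp [eval, map, sem]

theorem mem_preds_map {f : G → H} {a : Node n G} {w : H} :
    w ∈ (a.map f).preds ↔ ∃ u ∈ a.preds, f u = w := by
  cases a <;> simp [map, preds, eq_comm]

theorem card_preds_map_le (f : G → H) (a : Node n G) :
    (a.map f).preds.card ≤ a.preds.card := by
  classical
  cases a <;> simp [map, preds]
  all_goals convert Finset.card_image_le

theorem eval_congr {x : Fin n → Bool} {a : Node n G} {v w : G → Prop}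
    (h : ∀ u ∈ a.preds, v u ↔ w u) : a.eval x v ↔ a.eval x w := by
  cases a with
  | input j => exact Iff.rfl
  | const b => exact Iff.rfl
  | not u => exact not_congr (h u (Finset.mem_singleton_self u))
  | and us => exact forall₂_congr h
  | or us => exact exists_congr fun u => exists_congr fun hu => h u hu

end Node

/-- The fan-in restriction imposed on a gate in the given mode. -/
def Mode.Admits {n : ℕ} {G : Type} : Mode → Node n G → Prop
  | .unbounded, _ => True
  | .bounded, a => a.preds.card ≤ 2

theorem Mode.Admits.map {n : ℕ} {G H : Type} {b : Mode} {a : Node n G} (h : b.Admits a)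
    (f : G → H) : b.Admits (a.map f) := by
  cases b
  · trivial
  · exact (Node.card_preds_map_le f a).trans h

theorem Mode.admits_of_card_le {n : ℕ} {G : Type} (b : Mode) {a : Node n G}
    (h : a.preds.card ≤ 2) : b.Admits a := by
  cases b
  · trivial
  · exact h

/-- The family `F` of Boolean functions is computed by a circuit with at most `s` gates, of depth
at most `d`. -/
def Comp (b : Mode) {N : ℕ} {ι : Type} (F : ι → (Fin N → Bool) → Prop) (s d : ℕ) : Prop :=
  ∃ (G : Type) (_ : Finite G) (node : G → Node N G) (rank : G → ℕ)
    (val : G → (Fin N → Bool) → Prop),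
    (∀ g, ∀ u ∈ (node g).preds, rank u < rank g) ∧ (∀ g, rank g ≤ d) ∧
    (∀ g x, val g x ↔ (node g).eval x fun u => val u x) ∧ (∀ g, b.Admits (node g)) ∧
    Nat.card G ≤ s ∧ ∀ j, ∃ g, ∀ x, F j x ↔ val g x

namespace Comp

variable {b : Mode} {N : ℕ} {ι κ : Type} {F : ι → (Fin N → Bool) → Prop}
  {H : κ → (Fin N → Bool) → Prop} {s d s' d' : ℕ}

theorem mono (h : Comp b F s d) (hs : s ≤ s') (hd : d ≤ d') : Comp b F s' d' := by
  obtain ⟨G, _, node, rank, val, h1, h2, h3, h4, h5, h6⟩ := h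
  exact ⟨G, ‹_›, node, rank, val, h1, fun g => (h2 g).trans hd, h3, h4, h5.trans hs, h6⟩

theorem reindex (h : Comp b F s d) (f : κ → ι) (hf : ∀ k x, H k x ↔ F (f k) x) :
    Comp b H s d := by
  obtain ⟨G, _, node, rank, val, h1, h2, h3, h4, h5, h6⟩ := h
  refine ⟨G, ‹_›, node, rank, val, h1, h2, h3, h4, h5, fun k => ?_⟩
  obtain ⟨g, hg⟩ := h6 (f k)
  exact ⟨g, fun x => (hf k x).trans (hg x)⟩

theorem empty [IsEmpty ι] : Comp b F 0 0 :=
  ⟨Empty, inferInstance, fun g => g.elim, fun _ => 0, fun g => g.elim, fun g => g.elim,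
    fun g => g.elim, fun g => g.elim, fun g => g.elim, by simp, fun j => isEmptyElim j⟩

/-- Adding one layer of gates. -/
theorem layer [Finite κ] (h : Comp b F s d) (nd : κ → Node N ι) (hb : ∀ k, b.Admits (nd k))
    (hH : ∀ k x, H k x ↔ (nd k).eval x fun j => F j x) :
    Comp b (Sum.elim F H) (s + Nat.card κ) (d + 1) := by
  obtain ⟨G, _, node, rank, val, h1, h2, h3, h4, h5, h6⟩ := h
  choose o ho using h6
  refine ⟨G ⊕ κ, inferInstance,
    Sum.elim (fun g => (node g).map Sum.inl) (fun k => (nd k).map fun j => Sum.inl (o j)),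
    Sum.elim rank (fun _ => d + 1), Sum.elim val H, ?_, ?_, ?_, ?_, ?_, ?_⟩
  · rintro (g | k) u hu
    · obtain ⟨w, hw, rfl⟩ := Node.mem_preds_map.1 hu
      exact h1 g w hw
    · obtain ⟨w, hw, rfl⟩ := Node.mem_preds_map.1 hu
      exact Nat.lt_succ_of_le (h2 _)
  · rintro (g | k)
    · exact (h2 g).trans (Nat.le_succ d)
    · exact le_rfl
  · rintro (g | k) x
    · exact (h3 g x).trans (Node.eval_map x Sum.inl (node g) fun u => Sum.elim val H u x).symm
    · refine (hH k x).trans (Iff.trans ?_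
        (Node.eval_map x (fun j => Sum.inl (o j)) (nd k) fun u => Sum.elim val H u x).symm)
      exact Node.eval_congr fun j _ => ho j x
  · rintro (g | k)
    · exact (h4 g).map _
    · exact (hb k).map _
  · rw [Nat.card_sum]
    omega
  · rintro (j | k)
    · exact ⟨Sum.inl (o j), ho j⟩
    · exact ⟨Sum.inr k, fun x => Iff.rfl⟩

/-- Putting two circuits side by side. -/
theorem sum (h : Comp b F s d) (h' : Comp b H s' d') :
    Comp b (Sum.elim F H) (s + s') (max d d') := by
  obtain ⟨G, _, node, rank, val, h1, h2, h3, h4, h5, h6⟩ := h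
  obtain ⟨G', _, node', rank', val', h1', h2', h3', h4', h5', h6'⟩ := h'
  refine ⟨G ⊕ G', inferInstance,
    Sum.elim (fun g => (node g).map Sum.inl) (fun g => (node' g).map Sum.inr),
    Sum.elim rank rank', Sum.elim val val', ?_, ?_, ?_, ?_, ?_, ?_⟩
  · rintro (g | g) u hu
    · obtain ⟨w, hw, rfl⟩ := Node.mem_preds_map.1 hu
      exact h1 g w hw
    · obtain ⟨w, hw, rfl⟩ := Node.mem_preds_map.1 hu
      exact h1' g w hw
  · rintro (g | g)
    · exact (h2 g).trans (le_max_left _ _)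
    · exact (h2' g).trans (le_max_right _ _)
  · rintro (g | g) x
    · exact (h3 g x).trans (Node.eval_map x Sum.inl (node g) fun u => Sum.elim val val' u x).symm
    · exact (h3' g x).trans (Node.eval_map x Sum.inr (node' g) fun u => Sum.elim val val' u x).symm
  · rintro (g | g)
    · exact (h4 g).map _
    · exact (h4' g).map _
  · rw [Nat.card_sum]
    omega
  · rintro (j | j)
    · obtain ⟨g, hg⟩ := h6 j
      exact ⟨Sum.inl g, hg⟩
    · obtain ⟨g, hg⟩ := h6' j
      exact ⟨Sum.inr g, hg⟩

/-- Conjunctions of at most `2 ^ l` functions by binary trees. -/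
theorem tree_and (l : ℕ) : ∀ {κ : Type} [Finite κ] {H : κ → (Fin N → Bool) → Prop}
    (_ : Comp b F s d) (J : κ → Finset ι) (_ : ∀ k, (J k).card ≤ 2 ^ l)
    (_ : ∀ k x, H k x ↔ ∀ j ∈ J k, F j x),
    Comp b (Sum.elim F H) (s + Nat.card κ * 4 ^ l) (d + (l + 1)) := by
  classical
  induction l with
  | zero =>
    intro κ _ H h J hJ hH
    refine (h.layer (fun k => .and (J k)) (fun k => b.admits_of_card_le ?_) ?_).mono
      (by simp) (by simp)
    · have := hJ k
      simp only [Node.preds]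
      omega
    · exact fun k x => (hH k x).trans (by simp [Node.eval, Node.sem])
  | succ l ih =>
    intro κ _ H h J hJ hH
    -- Cut each index set into two halves of size at most `2 ^ l`.
    have hsplit : ∀ k, ∃ S ⊆ J k, S.card ≤ 2 ^ l ∧ (J k \ S).card ≤ 2 ^ l := by
      intro k
      obtain ⟨S, hS, hc⟩ := Finset.exists_subset_card_eq (Nat.div_le_self (J k).card 2)
      refine ⟨S, hS, ?_, ?_⟩
      · have := hJ k
        omega
      · have := hJ k
        rw [Finset.card_sdiff_of_subset hS]
        omega
    choose S hS hS1 hS2 using hsplit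
    -- Both halves of all conjunctions go through one call of the induction hypothesis. The count is
    -- `2 * |κ| * 4 ^ l + |κ| ≤ |κ| * 4 ^ (l + 1)`.
    have h' := ih (κ := κ × Bool) h (fun k => if k.2 then S k.1 else J k.1 \ S k.1)
      (fun k => by split <;> simp [hS1, hS2]) (fun k x => Iff.rfl)
    have h'' := h'.layer (H := H) (fun k => .and {Sum.inr (k, true), Sum.inr (k, false)})
      (fun k => b.admits_of_card_le Finset.card_le_two) (fun k x => ?_)
    · refine (h''.reindex (Sum.map Sum.inl id) ?_).mono ?_ (by omega)
      · rintro (j | k) x <;> rfl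
      · rw [Nat.card_prod, Nat.card_eq_fintype_card (α := Bool), Fintype.card_bool, pow_succ]
        have : 1 ≤ 4 ^ l := Nat.one_le_pow _ _ (by norm_num)
        nlinarith [Nat.zero_le (Nat.card κ)]
    · rw [hH k x]
      simp only [Node.eval, Node.sem, Finset.mem_insert, Finset.mem_singleton, forall_eq_or_imp,
        forall_eq, Sum.elim_inr, if_true, Bool.false_eq_true, if_false, Finset.mem_sdiff]
      constructor
      · exact fun h => ⟨fun j hj => h j (hS k hj), fun j hj => h j hj.1⟩
      · intro h j hj
        by_cases hjS : j ∈ S k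
        · exact h.1 j hjS
        · exact h.2 j ⟨hj, hjS⟩

/-- A single function computed in the calculus is computed by a circuit. -/
theorem exists_circuit {f : (Fin N → Bool) → Prop} (h : Comp b (fun _ : Unit => f) s d) :
    ∃ C : Circuit N, C.size ≤ s ∧ C.depth ≤ d ∧ (∀ g, b.Admits (C.node g)) ∧
      ∀ x, C.Accepts x ↔ f x := by
  obtain ⟨G, _, node, rank, val, h1, h2, h3, h4, h5, h6⟩ := h
  obtain ⟨o, ho⟩ := h6 ()
  let _ := Fintype.ofFinite G
  have hwf : WellFounded fun u g : G => u ∈ (node g).preds :=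
    Subrelation.wf (fun {u g} h => h1 g u h) (InvImage.wf rank wellFounded_lt)
  let C : Circuit N := ⟨G, node, o, hwf⟩
  refine ⟨C, ?_, ?_, h4, ?_⟩
  · rw [Nat.card_eq_fintype_card] at h5
    exact h5
  -- `rank` increases strictly along wires, so it dominates the longest path ending in a gate.
  · have hr : ∀ g : G, C.gateDepth g ≤ rank g := by
      intro g
      induction g using hwf.induction with
      | _ g ih =>
        rw [Circuit.gateDepth_eq]
        refine Finset.sup_le fun u hu => ?_
        have := ih u hu
        have := h1 g u hu
        omega
    exact Finset.sup_le fun g _ => (hr g).trans (h2 g)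
  · intro x
    refine Iff.trans ?_ (ho x).symm
    have : ∀ g : G, C.value x g ↔ val g x := by
      intro g
      induction g using hwf.induction with
      | _ g ih =>
        rw [Circuit.value_eq, h3 g x]
        exact Node.eval_congr (a := node g) ih
    exact this o

end Comp

/-! ## Growth rates -/

/-- `f` is polynomially bounded. -/
def PolyBdd (f : ℕ → ℕ) : Prop := ∃ K, ∀ n, f n ≤ (n + 2) ^ K

namespace PolyBdd

variable {f g : ℕ → ℕ}

theorem mono (hg : PolyBdd g) (h : ∀ n, f n ≤ g n) : PolyBdd f := by
  obtain ⟨K, hK⟩ := hg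
  exact ⟨K, fun n => (h n).trans (hK n)⟩

/-- The base `n + 2` is at least `2`, so constants are absorbed by the exponent and the bounds hold
at every `n`, including `0` and `1`. -/
theorem const (c : ℕ) : PolyBdd fun _ => c :=
  ⟨c, fun n => (Nat.lt_two_pow_self).le.trans (Nat.pow_le_pow_left (by omega) c)⟩

theorem self : PolyBdd fun n => n := ⟨1, fun n => by simp⟩

theorem mul (hf : PolyBdd f) (hg : PolyBdd g) : PolyBdd fun n => f n * g n := by
  obtain ⟨K, hK⟩ := hf
  obtain ⟨M, hM⟩ := hg
  exact ⟨K + M, fun n => by rw [pow_add]; exact Nat.mul_le_mul (hK n) (hM n)⟩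

theorem add (hf : PolyBdd f) (hg : PolyBdd g) : PolyBdd fun n => f n + g n := by
  obtain ⟨K, hK⟩ := hf
  obtain ⟨M, hM⟩ := hg
  refine ⟨K + M + 1, fun n => ?_⟩
  have h1 : (n + 2) ^ K ≤ (n + 2) ^ (K + M) := Nat.pow_le_pow_right (by omega) (by omega)
  have h2 : (n + 2) ^ M ≤ (n + 2) ^ (K + M) := Nat.pow_le_pow_right (by omega) (by omega)
  have := hK n
  have := hM n
  rw [pow_succ]
  nlinarith [Nat.zero_le (n * (n + 2) ^ (K + M))]

theorem pow (hf : PolyBdd f) (k : ℕ) : PolyBdd fun n => f n ^ k := by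
  induction k with
  | zero => simpa using const 1
  | succ k ih => simpa only [pow_succ] using ih.mul hf

end PolyBdd

/-- `f` is bounded by a multiple of the `i`-th power of the logarithm. -/
def LogBdd (i : ℕ) (f : ℕ → ℕ) : Prop := ∃ K, ∀ n, f n ≤ K * (Nat.log 2 n + 1) ^ i

namespace LogBdd

variable {i : ℕ} {f g : ℕ → ℕ}

theorem const (c : ℕ) : LogBdd i fun _ => c :=
  ⟨c, fun _ => Nat.le_mul_of_pos_right _ (Nat.pow_pos (Nat.succ_pos _))⟩

theorem add (hf : LogBdd i f) (hg : LogBdd i g) : LogBdd i fun n => f n + g n := by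
  obtain ⟨K, hK⟩ := hf
  obtain ⟨M, hM⟩ := hg
  exact ⟨K + M, fun n => by rw [add_mul]; exact Nat.add_le_add (hK n) (hM n)⟩

theorem mul_const (hf : LogBdd i f) (c : ℕ) : LogBdd i fun n => f n * c := by
  obtain ⟨K, hK⟩ := hf
  exact ⟨K * c, fun n => (Nat.mul_le_mul_right c (hK n)).trans_eq (by ring)⟩

theorem pow (hf : LogBdd 1 f) (i : ℕ) : LogBdd i fun n => f n ^ i := by
  obtain ⟨K, hK⟩ := hf
  refine ⟨K ^ i, fun n => ?_⟩
  rw [← mul_pow]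
  exact Nat.pow_le_pow_left (by simpa using hK n) i

theorem of_one (hf : LogBdd 1 f) (hi : 1 ≤ i) : LogBdd i f := by
  obtain ⟨K, hK⟩ := hf
  exact ⟨K, fun n => (hK n).trans
    (Nat.mul_le_mul_left K (Nat.pow_le_pow_right (Nat.succ_pos _) hi))⟩

theorem polyBdd (hf : LogBdd i f) : PolyBdd f := by
  obtain ⟨K, hK⟩ := hf
  refine PolyBdd.mono ((PolyBdd.const K).mul ((PolyBdd.self.add (PolyBdd.const 1)).pow i))
    fun n => (hK n).trans ?_
  exact Nat.mul_le_mul_left K (Nat.pow_le_pow_left (Nat.succ_le_succ (Nat.log_le_self 2 n)) i)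

end LogBdd

/-- Taking logarithms of `(n + 2) ^ K` turns the exponent into a factor. This makes binary trees
over polynomially many inputs logarithmically deep. -/
theorem PolyBdd.log {f : ℕ → ℕ} (hf : PolyBdd f) : LogBdd 1 fun n => Nat.log 2 (f n) := by
  obtain ⟨K, hK⟩ := hf
  refine ⟨2 * K, fun n => ?_⟩
  have h : n + 2 ≤ 2 ^ (Nat.log 2 n + 2) := by
    have h1 : n < 2 ^ (Nat.log 2 n + 1) := Nat.lt_pow_succ_log_self (by norm_num) n
    have h2 : 1 ≤ 2 ^ Nat.log 2 n := Nat.one_le_two_pow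
    rw [pow_succ] at h1 ⊢
    omega
  calc Nat.log 2 (f n) ≤ Nat.log 2 (2 ^ ((Nat.log 2 n + 2) * K)) := by
        refine Nat.log_mono_right ((hK n).trans ?_)
        rw [pow_mul]
        exact Nat.pow_le_pow_left h K
    _ = (Nat.log 2 n + 2) * K := Nat.log_pow (by norm_num) _
    _ ≤ 2 * K * (Nat.log 2 n + 1) ^ 1 := by
        rw [pow_one]
        nlinarith [Nat.zero_le (K * Nat.log 2 n)]

/-- The types `κ n` are finite, of polynomially bounded size. -/
def PolyCard (κ : ℕ → Type) : Prop := (∀ n, Finite (κ n)) ∧ PolyBdd fun n => Nat.card (κ n)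

namespace PolyCard

variable {κ μ : ℕ → Type}

theorem of_finite (α : Type) [Finite α] : PolyCard fun _ => α :=
  ⟨fun _ => inferInstance, PolyBdd.const _⟩

theorem fin : PolyCard Fin := ⟨fun _ => inferInstance, by simpa using PolyBdd.self⟩

theorem prod (hκ : PolyCard κ) (hμ : PolyCard μ) : PolyCard fun n => κ n × μ n := by
  refine ⟨fun n => ?_, ?_⟩
  · have := hκ.1 n
    have := hμ.1 n
    infer_instance
  · simpa only [Nat.card_prod] using hκ.2.mul hμ.2

theorem pi (α : Type) [Finite α] (hκ : PolyCard κ) : PolyCard fun n => α → κ n := by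
  refine ⟨fun n => ?_, ?_⟩
  · have := hκ.1 n
    infer_instance
  · simpa only [Nat.card_fun] using hκ.2.pow (Nat.card α)

end PolyCard

/-! ## Uniform families of circuits -/

/-- The families `F n` of Boolean functions are computed by circuits of polynomial size and of depth
`O(log ^ i)`. -/
def Computes (b : Mode) (i : ℕ) {N : ℕ → ℕ} {ι : ℕ → Type}
    (F : ∀ n, ι n → (Fin (N n) → Bool) → Prop) : Prop :=
  ∃ s d : ℕ → ℕ, PolyBdd s ∧ LogBdd i d ∧ ∀ n, Comp b (F n) (s n) (d n)

namespace Computes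

variable {b : Mode} {i : ℕ} {N : ℕ → ℕ} {ι κ β : ℕ → Type}
  {F F' : ∀ n, ι n → (Fin (N n) → Bool) → Prop} {H : ∀ n, κ n → (Fin (N n) → Bool) → Prop}

theorem reindex (h : Computes b i F) (f : ∀ n, κ n → ι n) (hf : ∀ n k x, H n k x ↔ F n (f n k) x) :
    Computes b i H := by
  obtain ⟨s, d, hs, hd, h⟩ := h
  exact ⟨s, d, hs, hd, fun n => (h n).reindex (f n) (hf n)⟩

theorem sum (h : Computes b i F) (h' : Computes b i H) :
    Computes b i fun n => Sum.elim (F n) (H n) := by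
  obtain ⟨s, d, hs, hd, h⟩ := h
  obtain ⟨s', d', hs', hd', h'⟩ := h'
  exact ⟨_, _, hs.add hs', hd.add hd', fun n => ((h n).sum (h' n)).mono le_rfl (by omega)⟩

theorem layer (h : Computes b i F) (hκ : PolyCard κ) (nd : ∀ n, κ n → Node (N n) (ι n))
    (hb : ∀ n k, b.Admits (nd n k))
    (hH : ∀ n k x, H n k x ↔ (nd n k).eval x fun j => F n j x) : Computes b i H := by
  obtain ⟨s, d, hs, hd, h⟩ := h
  refine ⟨_, _, hs.add hκ.2, hd.add (LogBdd.const 1), fun n => ?_⟩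
  have := hκ.1 n
  exact ((h n).layer (nd n) (hb n) (hH n)).reindex Sum.inr fun _ _ => Iff.rfl

theorem of_nodes (hκ : PolyCard κ) (nd : ∀ n, κ n → Node (N n) Empty)
    (hH : ∀ n k x, H n k x ↔ (nd n k).eval x fun _ => False) : Computes b i H := by
  have h : Computes b i (N := N) (ι := fun _ => Empty) fun _ _ _ => False :=
    ⟨_, _, PolyBdd.const 0, LogBdd.const 0, fun n => Comp.empty⟩
  exact h.layer hκ nd (fun n k => b.admits_of_card_le
    ((Finset.card_le_univ _).trans (by simp))) hH

theorem const (hκ : PolyCard κ) (Q : ∀ n, κ n → Prop) :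
    Computes b i (N := N) fun n k _ => Q n k := by
  classical
  exact of_nodes hκ (fun n k => .const (decide (Q n k))) fun n k x => by simp [Node.eval, Node.sem]

theorem input (hκ : PolyCard κ) (p : ∀ n, κ n → Fin (N n)) :
    Computes b i fun n k x => x (p n k) = true :=
  of_nodes hκ (fun n k => .input (p n k)) fun _ _ _ => Iff.rfl

theorem not (hι : PolyCard ι) (h : Computes b i F) : Computes b i fun n j x => ¬ F n j x :=
  h.layer hι (fun _ j => .not j) (fun _ _ => b.admits_of_card_le (by simp [Node.preds]))
    fun _ _ _ => Iff.rfl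

theorem and (hι : PolyCard ι) (h : Computes b i F) (h' : Computes b i F') :
    Computes b i fun n j x => F n j x ∧ F' n j x := by
  classical
  exact (h.sum h').layer hι (fun _ j => .and {Sum.inl j, Sum.inr j})
    (fun _ _ => b.admits_of_card_le Finset.card_le_two)
    fun _ _ _ => by simp [Node.eval, Node.sem]

theorem or (hι : PolyCard ι) (h : Computes b i F) (h' : Computes b i F') :
    Computes b i fun n j x => F n j x ∨ F' n j x := by
  classical
  exact (h.sum h').layer hι (fun _ j => .or {Sum.inl j, Sum.inr j})
    (fun _ _ => b.admits_of_card_le Finset.card_le_two)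
    fun _ _ _ => by simp [Node.eval, Node.sem]

/-- With unbounded fan-in this is one gate per output; with fan-in two it is a binary tree, whose
logarithmic depth fits into `O(log ^ i)` because `1 ≤ i`. -/
theorem bigAnd (hb : b = .bounded → 1 ≤ i) (hκ : PolyCard κ) (hβ : PolyCard β)
    (h : Computes b i F) (j : ∀ n, κ n → β n → ι n) :
    Computes b i fun n k x => ∀ c, F n (j n k c) x := by
  classical
  have hfin := hβ.1
  have (n : ℕ) : Fintype (β n) := Fintype.ofFinite _
  cases b with
  | unbounded =>
    exact h.layer hκ (fun n k => .and (Finset.univ.image (j n k))) (fun _ _ => trivial)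
      fun _ _ _ => by simp [Node.eval, Node.sem]
  | bounded =>
    obtain ⟨s, d, hs, hd, h⟩ := h
    -- The trees have height about `log |β|`, and `2 ^ (log |β| + 1) ≤ 2 * (|β| + 1)`, so the gate
    -- count is quadratic in `|β|`.
    have h4 : PolyBdd fun n => 4 ^ (Nat.log 2 (Nat.card (β n)) + 1) := by
      refine (((PolyBdd.const 2).mul (hβ.2.add (PolyBdd.const 1))).pow 2).mono fun n => ?_
      rw [show 4 = 2 ^ 2 by norm_num, ← pow_mul, mul_comm, pow_mul]
      refine Nat.pow_le_pow_left ?_ 2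
      rw [pow_succ, mul_comm]
      refine Nat.mul_le_mul_left 2 ?_
      rcases Nat.eq_zero_or_pos (Nat.card (β n)) with h0 | h0
      · rw [h0]
        simp
      · exact (Nat.pow_log_le_self 2 h0.ne').trans (Nat.le_succ _)
    refine ⟨_, _, hs.add (hκ.2.mul h4),
      hd.add (((hβ.2.log.add (LogBdd.const 1)).add (LogBdd.const 1)).of_one (hb rfl)),
      fun n => ?_⟩
    have := hκ.1 n
    refine ((h n).tree_and (Nat.log 2 (Nat.card (β n)) + 1)
      (fun k => Finset.univ.image (j n k)) (fun k => ?_) (fun k x => ?_)).reindex Sum.inr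
        fun _ _ => Iff.rfl
    · refine Finset.card_image_le.trans ?_
      rw [Finset.card_univ, ← Nat.card_eq_fintype_card]
      exact (Nat.lt_pow_succ_log_self (by norm_num) _).le
    · simp

theorem bigOr (hb : b = .bounded → 1 ≤ i) (hι : PolyCard ι) (hκ : PolyCard κ) (hβ : PolyCard β)
    (h : Computes b i F) (j : ∀ n, κ n → β n → ι n) :
    Computes b i fun n k x => ∃ c, F n (j n k c) x :=
  (((h.not hι).bigAnd hb hκ hβ j).not hκ).reindex (fun _ k => k) fun _ _ _ => by
    simp only [not_forall, not_not]

end Computes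

/-! ## First-order formulas -/

section FirstOrder

variable {σ : Vocabulary} {N : ℕ → ℕ}

/-- The structure whose atomic facts are read off the input bits at the positions `pos`. -/
def structAt {n M : ℕ} (pos : (r : Fin σ.card) → (Fin (σ.arity r) → Fin n) → Fin M)
    (x : Fin M → Bool) : Struct σ n := fun r v => x (pos r v)

theorem computes_boundedFormula {b : Mode} {i : ℕ} (hb : b = .bounded → 1 ≤ i)
    (pos : ∀ n, (r : Fin σ.card) → (Fin (σ.arity r) → Fin n) → Fin (N n))
    {α : Type} [Finite α] {k : ℕ} (φ : (arbLanguage σ).BoundedFormula α k) :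
    Computes b i fun n (v : (α → Fin n) × (Fin k → Fin n)) x =>
      @FirstOrder.Language.BoundedFormula.Realize _ _ (structAt (pos n) x).toStructure _ _
        φ v.1 v.2 := by
  have hP (k : ℕ) : PolyCard fun n => (α → Fin n) × (Fin k → Fin n) :=
    (PolyCard.fin.pi α).prod (PolyCard.fin.pi (Fin k))
  -- There are no function symbols, so every term is a variable.
  have hterm {n k : ℕ} (t : (arbLanguage σ).Term (α ⊕ Fin k)) : ∃ a, t = .var a := by
    cases t with
    | var a => exact ⟨a, rfl⟩
    | func f ts => exact Empty.elim f
  induction φ with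
  | falsum =>
    exact (Computes.const (hP _) fun _ _ => False).reindex (fun _ v => v) fun _ _ _ => Iff.rfl
  | equal t₁ t₂ =>
    obtain ⟨a₁, rfl⟩ := hterm (n := 0) t₁
    obtain ⟨a₂, rfl⟩ := hterm (n := 0) t₂
    exact (Computes.const (hP _) fun _ v => Sum.elim v.1 v.2 a₁ = Sum.elim v.1 v.2 a₂).reindex
      (fun _ v => v) fun _ _ _ => Iff.rfl
  | rel R ts =>
    choose a ha using fun t => hterm (n := 0) (ts t)
    obtain rfl : ts = fun t => .var (a t) := funext ha
    cases R with
    | input r =>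
      exact (Computes.input (hP _) fun n v => pos n r fun t => Sum.elim v.1 v.2 (a t)).reindex
        (fun _ v => v) fun _ _ _ => Iff.rfl
    | numerical P =>
      exact (Computes.const (hP _) fun n v => P n fun t => Sum.elim v.1 v.2 (a t)).reindex
        (fun _ v => v) fun _ _ _ => Iff.rfl
  | imp f₁ f₂ ih₁ ih₂ =>
    exact ((ih₁.not (hP _)).or (hP _) ih₂).reindex (fun _ v => v) fun _ _ _ =>
      imp_iff_not_or
  | all f ih =>
    exact (ih.bigAnd hb (hP _) PolyCard.fin fun n v a => (v.1, Fin.snoc v.2 a)).reindex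
      (fun _ v => v) fun _ _ _ => Iff.rfl

theorem computes_formula {b : Mode} {i : ℕ} (hb : b = .bounded → 1 ≤ i)
    (pos : ∀ n, (r : Fin σ.card) → (Fin (σ.arity r) → Fin n) → Fin (N n))
    {α : Type} [Finite α] (φ : (arbLanguage σ).Formula α) :
    Computes b i fun n (v : α → Fin n) x =>
      @FirstOrder.Language.Formula.Realize _ _ (structAt (pos n) x).toStructure _ φ v :=
  (computes_boundedFormula hb pos φ).reindex (fun _ v => (v, default)) fun _ _ _ => Iff.rfl

end FirstOrder

/-! ## The order on tuples -/

section Tuples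

variable {i m q n : ℕ}

/-- `finFunctionFinEquiv` reads the least significant digit first, hence the reversal. Bijectivity
of base-`n` notation is then inherited from it. -/
theorem tupleValue_eq (t : Fin m → Fin n) :
    tupleValue t = (finFunctionFinEquiv (t ∘ Fin.rev) : ℕ) := by
  rw [tupleValue, finFunctionFinEquiv_apply]
  exact (Equiv.sum_comp Fin.revPerm _).symm.trans (by simp)

theorem tupleValue_lt (t : Fin m → Fin n) : tupleValue t < n ^ m := by
  rw [tupleValue_eq]
  exact Fin.is_lt _

theorem tupleValue_injective : Function.Injective (tupleValue : (Fin m → Fin n) → ℕ) := by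
  intro s t h
  rw [tupleValue_eq, tupleValue_eq, Fin.val_inj, finFunctionFinEquiv.apply_eq_iff_eq] at h
  funext k
  simpa using congrFun h k.rev

theorem exists_tupleValue_eq {v : ℕ} (hv : v < n ^ m) : ∃ t : Fin m → Fin n, tupleValue t = v := by
  refine ⟨finFunctionFinEquiv.symm ⟨v, hv⟩ ∘ Fin.rev, ?_⟩
  rw [tupleValue_eq, Function.comp_assoc, Fin.rev_involutive.comp_self, Function.comp_id,
    Equiv.apply_symm_apply]

/-- The tuple order as an order on a linearly ordered set. -/
def lexKey (z : RecTuple i m q n) : Lex (Lex (Fin i → ℕ) × ℕ) :=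
  toLex (toLex (blockValue z), lastValue z)

theorem lexLT_iff (z u : RecTuple i m q n) : LexLT z u ↔ lexKey z < lexKey u := by
  rw [lexKey, lexKey, Prod.Lex.toLex_lt_toLex]
  refine or_congr ?_ (and_congr_left fun _ => ?_)
  · exact exists_congr fun j => and_comm
  · rw [toLex.apply_eq_iff_eq, funext_iff]

theorem lexKey_injective : Function.Injective (lexKey : RecTuple i m q n → _) := by
  intro z u h
  have h' := Prod.ext_iff.1 (toLex.injective h)
  funext v
  rcases v with ⟨j, k⟩ | k
  · exact congrFun (tupleValue_injective (congrFun (toLex.injective h'.1) j)) k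
  · exact congrFun (tupleValue_injective h'.2) k

-- Of three elements of the range, the least would have two distinct elements of `R` above it. This
-- gives fan-in two for gates that simulate bounded quantifications.
open Classical in
theorem card_range_bounded_le (R : RecTuple i m q n → Prop) :
    (Finset.univ.filter (Mode.bounded.Range R)).card ≤ 2 := by
  by_contra! hc
  obtain ⟨z, hz, hmin⟩ := Finset.exists_min_image _ lexKey
    (Finset.card_pos.1 (lt_trans Nat.zero_lt_two hc))
  have h1 : 1 < ((Finset.univ.filter (Mode.bounded.Range R)).erase z).card := by
    rw [Finset.card_erase_of_mem hz]
    omega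
  obtain ⟨u, hu, v, hv, huv⟩ := Finset.one_lt_card.1 h1
  obtain ⟨huz, hu⟩ := Finset.mem_erase.1 hu
  obtain ⟨hvz, hv⟩ := Finset.mem_erase.1 hv
  have hlt : ∀ w, w ≠ z → lexKey z ≤ lexKey w → LexLT z w := fun w hw h =>
    (lexLT_iff z w).2 (lt_of_le_of_ne h fun e => hw (lexKey_injective e.symm))
  have hR := (Finset.mem_filter_univ z).1 hz |>.2 u v huv (hlt u huz (hmin u hu)) (hlt v hvz (hmin v hv))
  exact hR.elim (fun h => h ((Finset.mem_filter_univ u).1 hu).1)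
    fun h => h ((Finset.mem_filter_univ v).1 hv).1

/-- The bounded mode excludes nothing from a set with at most two elements. This is how the wires of
a fan-in-two circuit survive the restriction. -/
theorem Mode.range_iff_of_card_le (b : Mode) {R : RecTuple i m q n → Prop}
    (hR : b = .bounded → ∀ u v w, R u → R v → R w → u = v ∨ u = w ∨ v = w)
    (z : RecTuple i m q n) : b.Range R z ↔ R z := by
  cases b with
  | unbounded => exact Iff.rfl
  | bounded =>
    refine ⟨fun h => h.1, fun h => ⟨h, fun u v huv hu hv => ?_⟩⟩
    by_contra! hRuv
    rw [lexLT_iff] at hu hv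
    rcases hR rfl z u v h hRuv.1 hRuv.2 with rfl | rfl | rfl
    · exact lt_irrefl _ hu
    · exact lt_irrefl _ hv
    · exact huv rfl

/-- The lexicographic enumeration of the tuples of digits. -/
noncomputable def lexOrderIso (i B : ℕ) : Fin (B ^ i) ≃o Lex (Fin i → Fin B) :=
  @Fintype.orderIsoFinOfCardEq (Lex (Fin i → Fin B)) _
    (inferInstanceAs (Fintype (Fin i → Fin B))) (B ^ i) (by
      change Fintype.card (Fin i → Fin B) = B ^ i
      simp)

/-- Halving drops the last binary digit. `Nat.size` is used because it also separates `0` from `1`,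
which `Nat.log 2` does not. -/
theorem size_lt_size_of_halved {a c : ℕ} (hc : 0 < c) (h : 2 * a ≤ c) : a.size < c.size := by
  rw [Nat.lt_size]
  rcases Nat.eq_zero_or_pos a with rfl | ha
  · simpa using Nat.succ_le_of_lt hc
  · have h1 : 2 ^ (a.size - 1) ≤ a := Nat.lt_size.1 (by have := Nat.size_pos.2 ha; omega)
    have h2 : a.size = a.size - 1 + 1 := by have := Nat.size_pos.2 ha; omega
    rw [h2, pow_succ]
    omega

/-- The guards decrease a rank that is bounded by the `i`-th power of the logarithm. -/
theorem exists_guard_rank (i m q : ℕ) : ∃ T : ℕ → ℕ, LogBdd i T ∧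
    ∀ n, ∃ rank : RecTuple i m q n → ℕ,
      (∀ y, rank y < T n) ∧ ∀ y z, Guard y z → rank z < rank y := by
  refine ⟨fun n => (Nat.log 2 (n ^ m) + 2) ^ i,
    (((PolyBdd.self.pow m).log).add (LogBdd.const 2)).pow i, fun n => ?_⟩
  -- Block values are below `n ^ m`, so their bit lengths are at most `B - 1` and serve as digits in
  -- base `B`.
  set B := Nat.log 2 (n ^ m) + 2
  have hB : ∀ (y : RecTuple i m q n) (j : Fin i), (blockValue y j).size < B := fun y j =>
    Nat.lt_succ_of_le (Nat.size_le.2 ((tupleValue_lt _).trans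
      (Nat.lt_pow_succ_log_self (by norm_num) _)))
  let e := lexOrderIso i B
  let f (y : RecTuple i m q n) : Lex (Fin i → Fin B) := toLex fun j => ⟨_, hB y j⟩
  refine ⟨fun y => e.symm (f y), fun y => Fin.is_lt _, fun y z hg => ?_⟩
  refine Fin.lt_def.1 (e.symm.lt_iff_lt.2 ?_)
  obtain ⟨j, ⟨h0, h2⟩, hk⟩ := hg
  have hj := size_lt_size_of_halved h0 h2
  by_contra hn
  rcases (not_lt.1 hn).eq_or_lt with he | ⟨k, heq, hlt⟩
  · have := congrFun (toLex.injective he) j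
    simp only [Fin.mk.injEq] at this
    omega
  · simp only [f, Pi.toLex_apply, Fin.mk.injEq, Fin.mk_lt_mk] at heq hlt
    rcases lt_trichotomy k j with hkj | rfl | hjk
    · have := Nat.size_le_size (hk k hkj)
      omega
    · omega
    · have := heq j hjk
      omega

end Tuples

/-! ## Relative computations -/

/-- From any circuit that computes `F`, among other functions, the functions `H` are computed with
at most `s` additional gates and with depth increased by at most `d`. -/
def Derives (b : Mode) {N : ℕ} {ι κ : Type} (F : ι → (Fin N → Bool) → Prop)
    (H : κ → (Fin N → Bool) → Prop) (s d : ℕ) : Prop :=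
  ∀ (γ : Type) (E : γ → (Fin N → Bool) → Prop) (f : ι → γ), (∀ j x, F j x ↔ E (f j) x) →
    ∀ s₀ d₀, Comp b E s₀ d₀ → Comp b (Sum.elim E H) (s₀ + s) (d₀ + d)

namespace Derives

variable {b : Mode} {N : ℕ} {ι κ μ : Type} {F : ι → (Fin N → Bool) → Prop}
  {H : κ → (Fin N → Bool) → Prop} {K : μ → (Fin N → Bool) → Prop} {s d s' d' : ℕ}

theorem of_reindex (f : κ → ι) (hf : ∀ k x, H k x ↔ F (f k) x) : Derives b F H 0 0 :=
  fun _ _ g hg _ _ h => h.reindex (Sum.elim id fun k => g (f k)) <| by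
    rintro (j | k) x
    · rfl
    · exact (hf k x).trans (hg _ x)

theorem weaken (h : Derives b F H s d) (f : ι → μ) (hf : ∀ j x, F j x ↔ K (f j) x) :
    Derives b K H s d :=
  fun _ _ g hg => h _ _ (g ∘ f) fun j x => (hf j x).trans (hg _ x)

theorem layer [Finite κ] (nd : κ → Node N ι) (hb : ∀ k, b.Admits (nd k))
    (hH : ∀ k x, H k x ↔ (nd k).eval x fun j => F j x) : Derives b F H (Nat.card κ) 1 := by
  intro γ E f hf s₀ d₀ h
  refine h.layer (fun k => (nd k).map f) (fun k => (hb k).map f) fun k x => ?_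
  rw [Node.eval_map, hH]
  exact Node.eval_congr fun j _ => hf j x

/-- The ambient family `E` in `Derives` is arbitrary and is kept, so the second step shares the
gates of the first and costs simply add up. -/
theorem trans (h : Derives b F H s d) (h' : Derives b (Sum.elim F H) K s' d') :
    Derives b F K (s + s') (d + d') := by
  intro γ E f hf s₀ d₀ h₀
  refine ((h' _ _ (Sum.map f id) ?_ _ _ (h _ _ f hf _ _ h₀)).reindex
    (Sum.map Sum.inl id) ?_).mono (by omega) (by omega)
  · rintro (j | k) x
    · exact hf j x
    · rfl
  · rintro (j | k) x <;> rfl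

theorem pair (h : Derives b F H s d) (h' : Derives b F K s' d') :
    Derives b F (Sum.elim H K) (s + s') (d + d') := by
  intro γ E f hf s₀ d₀ h₀
  refine ((h' _ _ (fun j => Sum.inl (f j)) hf _ _ (h _ _ f hf _ _ h₀)).reindex
    (Sum.elim (fun j => Sum.inl (Sum.inl j)) (Sum.map Sum.inr id)) ?_).mono (by omega) (by omega)
  rintro (j | j | k) x <;> rfl

end Derives

/-! ## Circuits for guarded predicative recursion -/

section Recursion

variable {σ : Vocabulary} {N : ℕ → ℕ} {i : ℕ} {b : Mode}

-- Here `R` is a fixed set, independent of the input word. Guard sets are of this kind because `ξ`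
-- contains no symbol of the input structure, so they can serve as wiring.
open Classical in
theorem admits_image_range {i m q n M : ℕ} {G : Type} (b : Mode) (R : RecTuple i m q n → Prop)
    (f : RecTuple i m q n → G) (a : Node M G)
    (ha : a.preds = (Finset.univ.filter (b.Range R)).image f) : b.Admits a := by
  cases b with
  | unbounded => trivial
  | bounded =>
    change a.preds.card ≤ 2
    rw [ha]
    exact Finset.card_image_le.trans (card_range_bounded_le R)

/-- One round of a recursion costs polynomial size and constant depth, once the values of finitely
many first-order formulas are available. -/
theorem derives_body (hb : b = .bounded → 1 ≤ i)
    (pos : ∀ n, (r : Fin σ.card) → (Fin (σ.arity r) → Fin n) → Fin (N n))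
    {p m q d : ℕ} (θ : Body σ p i m q d) :
    -- `F` collects the first-order parts. It is chosen before `P` and is paid for once: recomputing
    -- it in each round would cost an extra logarithm of depth in bounded mode. Likewise `s` and `D`
    -- do not depend on `P`, so rounds can be iterated.
    ∃ (ι : ℕ → Type) (F : ∀ n, ι n → (Fin (N n) → Bool) → Prop), Computes b i F ∧
      ∃ (s : ℕ → ℕ) (D : ℕ), PolyBdd s ∧
        ∀ n (P : (Fin (N n) → Bool) → (Fin p → Fin n) → RecTuple i m q n → Prop),
          Derives b
            (Sum.elim (F n) fun (v : (Fin p → Fin n) × RecTuple i m q n) x => P x v.1 v.2)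
            (fun (v : (Fin p → Fin n) × RecTuple i m q n × (Fin d → RecTuple i m q n)) x =>
              θ.Realize b (structAt (pos n) x) (P x) v.1 v.2.1 v.2.2) (s n) D := by
  classical
  have hP (d : ℕ) : PolyCard fun n =>
      (Fin p → Fin n) × RecTuple i m q n × (Fin d → RecTuple i m q n) :=
    (PolyCard.fin.pi _).prod ((PolyCard.fin.pi _).prod ((PolyCard.fin.pi _).pi _))
  induction θ with
  | fo φ =>
    refine ⟨_, _, computes_formula hb pos φ, fun _ => 0, 0, PolyBdd.const 0, fun n P => ?_⟩
    exact Derives.of_reindex (fun v => Sum.inl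
      (Sum.elim v.1 (Sum.elim v.2.1 fun tv => v.2.2 tv.1 tv.2))) fun _ _ => Iff.rfl
  | @and d θ₁ θ₂ ih₁ ih₂ =>
    obtain ⟨ι₁, F₁, hF₁, s₁, D₁, hs₁, h₁⟩ := ih₁
    obtain ⟨ι₂, F₂, hF₂, s₂, D₂, hs₂, h₂⟩ := ih₂
    refine ⟨_, _, hF₁.sum hF₂, _, D₁ + D₂ + 1, (hs₁.add hs₂).add (hP d).2, fun n P => ?_⟩
    have := (hP d).1 n
    refine (((h₁ n P).weaken (Sum.map Sum.inl id) ?_).pair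
      ((h₂ n P).weaken (Sum.map Sum.inr id) ?_)).trans
      (Derives.layer (fun v => .and {Sum.inr (Sum.inl v), Sum.inr (Sum.inr v)})
        (fun _ => b.admits_of_card_le Finset.card_le_two) ?_)
    · rintro (j | k) x <;> rfl
    · rintro (j | k) x <;> rfl
    · intro v x
      simp [Node.eval, Node.sem, Body.Realize]
  | @or d θ₁ θ₂ ih₁ ih₂ =>
    obtain ⟨ι₁, F₁, hF₁, s₁, D₁, hs₁, h₁⟩ := ih₁
    obtain ⟨ι₂, F₂, hF₂, s₂, D₂, hs₂, h₂⟩ := ih₂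
    refine ⟨_, _, hF₁.sum hF₂, _, D₁ + D₂ + 1, (hs₁.add hs₂).add (hP d).2, fun n P => ?_⟩
    have := (hP d).1 n
    refine (((h₁ n P).weaken (Sum.map Sum.inl id) ?_).pair
      ((h₂ n P).weaken (Sum.map Sum.inr id) ?_)).trans
      (Derives.layer (fun v => .or {Sum.inr (Sum.inl v), Sum.inr (Sum.inr v)})
        (fun _ => b.admits_of_card_le Finset.card_le_two) ?_)
    · rintro (j | k) x <;> rfl
    · rintro (j | k) x <;> rfl
    · intro v x
      simp [Node.eval, Node.sem, Body.Realize]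
  | call t =>
    refine ⟨fun _ => Empty, fun _ _ _ => False,
      (Computes.const (PolyCard.of_finite Empty) fun _ _ => False), fun _ => 0, 0,
      PolyBdd.const 0, fun n P => ?_⟩
    exact Derives.of_reindex (fun v => Sum.inr (v.1, v.2.2 t)) fun _ _ => Iff.rfl
  | @all d ξ θ ih =>
    obtain ⟨ι, F, hF, s, D, hs, h⟩ := ih
    refine ⟨ι, F, hF, _, D + 1, hs.add (hP d).2, fun n P => ?_⟩
    have := (hP d).1 n
    refine (h n P).trans (Derives.layer
      (fun v => .and ((Finset.univ.filter (b.Range (GuardSet ξ v.2.1))).image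
        fun z => Sum.inr (v.1, v.2.1, Fin.snoc v.2.2 z)))
      (fun v => admits_image_range b _ _ _ rfl) ?_)
    intro v x
    simp [Node.eval, Node.sem, Body.Realize]
  | @ex d ξ θ ih =>
    obtain ⟨ι, F, hF, s, D, hs, h⟩ := ih
    refine ⟨ι, F, hF, _, D + 1, hs.add (hP d).2, fun n P => ?_⟩
    have := (hP d).1 n
    refine (h n P).trans (Derives.layer
      (fun v => .or ((Finset.univ.filter (b.Range (GuardSet ξ v.2.1))).image
        fun z => Sum.inr (v.1, v.2.1, Fin.snoc v.2.2 z)))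
      (fun v => admits_image_range b _ _ _ rfl) ?_)
    intro v x
    simp [Node.eval, Node.sem, Body.Realize]

/-- The `t`-th approximation to the relation defined by a recursion. -/
def Body.stage {p m q n : ℕ} (b : Mode) (A : Struct σ n) (θ : Body σ p i m q 0) :
    ℕ → (Fin p → Fin n) → RecTuple i m q n → Prop
  | 0 => fun _ _ => False
  | t + 1 => fun x y => θ.Realize b A (θ.stage b A t) x y Fin.elim0

/-- The body at `y` consults `P` only at guarded `z`, which have smaller rank, so stage `t` is
already correct at all ranks below `t`. -/
theorem Body.stage_iff {p m q n : ℕ} {A : Struct σ n} {θ : Body σ p i m q 0}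
    {P : (Fin p → Fin n) → RecTuple i m q n → Prop} (hP : θ.Defines b A P)
    {rank : RecTuple i m q n → ℕ} (hr : ∀ y z, Guard y z → rank z < rank y) (x : Fin p → Fin n) :
    ∀ (t : ℕ) (y : RecTuple i m q n), rank y < t → (θ.stage b A t x y ↔ P x y)
  | t + 1, y, hy => by
    refine Iff.trans ?_ (hP x y).symm
    exact θ.realize_congr (fun z hz => θ.stage_iff hP hr x t z (by have := hr y z hz; omega))
      _ fun t => t.elim0

/-- The relation defined by a recursion. -/
noncomputable def Body.rel {p m q n : ℕ} (b : Mode) (A : Struct σ n) (θ : Body σ p i m q 0) :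
    (Fin p → Fin n) → RecTuple i m q n → Prop :=
  (θ.existsUnique_defines b A).exists.choose

theorem Body.rel_defines {p m q n : ℕ} (b : Mode) (A : Struct σ n) (θ : Body σ p i m q 0) :
    θ.Defines b A (θ.rel b A) :=
  (θ.existsUnique_defines b A).exists.choose_spec

/-- Uniqueness of the defined relation replaces the existential quantifier in the semantics by
evaluation at one relation. -/
theorem Body.exists_defines_and {p m q n : ℕ} (b : Mode) (A : Struct σ n)
    (θ : Body σ p i m q 0) (Q : ((Fin p → Fin n) → RecTuple i m q n → Prop) → Prop) :
    (∃ P, θ.Defines b A P ∧ Q P) ↔ Q (θ.rel b A) := by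
  constructor
  · rintro ⟨P, hP, hQ⟩
    rwa [(θ.existsUnique_defines b A).unique (θ.rel_defines b A) hP]
  · exact fun h => ⟨_, θ.rel_defines b A, h⟩

theorem computes_rel (hb : b = .bounded → 1 ≤ i)
    (pos : ∀ n, (r : Fin σ.card) → (Fin (σ.arity r) → Fin n) → Fin (N n))
    {p m q : ℕ} (θ : Body σ p i m q 0) :
    Computes b i fun n (v : (Fin p → Fin n) × RecTuple i m q n) x =>
      θ.rel b (structAt (pos n) x) v.1 v.2 := by
  obtain ⟨ι, F, ⟨s₀, d₀, hs₀, hd₀, hF⟩, s, D, hs, h⟩ := derives_body hb pos θ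
  obtain ⟨T, hT, hrank⟩ := exists_guard_rank i m q
  have hP : PolyCard fun n => (Fin p → Fin n) × RecTuple i m q n :=
    (PolyCard.fin.pi _).prod (PolyCard.fin.pi _)
  -- The first-order parts cost `d₀`, the constant gates of stage `0` one more layer, and each round
  -- `D`.
  have key : ∀ n t, Comp b
      (Sum.elim (F n) fun (v : (Fin p → Fin n) × RecTuple i m q n) x =>
        θ.stage b (structAt (pos n) x) t v.1 v.2)
      (s₀ n + Nat.card ((Fin p → Fin n) × RecTuple i m q n) + t * s n) (d₀ n + 1 + t * D) := by
    intro n t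
    have := hP.1 n
    induction t with
    | zero =>
      refine ((hF n).layer (fun _ => .const false)
        (fun _ => b.admits_of_card_le (by simp [Node.preds])) ?_).mono (by simp) (by simp)
      intro v x
      simp [Node.eval, Node.sem, Body.stage]
    | succ t ih =>
      refine ((h n (fun x => θ.stage b (structAt (pos n) x) t) _ _ id
        (fun _ _ => Iff.rfl) _ _ ih).reindex
        (Sum.elim (fun j => Sum.inl (Sum.inl j)) fun v => Sum.inr (v.1, v.2, Fin.elim0)) ?_).mono
        (by rw [add_mul]; omega) (by rw [add_mul]; omega)
      rintro (j | v) x <;> rfl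
  refine ⟨_, _, (hs₀.add hP.2).add (hT.polyBdd.mul hs),
    (hd₀.add (LogBdd.const 1)).add (hT.mul_const D), fun n => (key n (T n)).reindex Sum.inr ?_⟩
  obtain ⟨rank, hlt, hr⟩ := hrank n
  intro v x
  exact (Body.stage_iff (θ.rel_defines b _) hr v.1 (T n) v.2 (hlt v.2)).symm

theorem computes_posFormula (hb : b = .bounded → 1 ≤ i)
    (pos : ∀ n, (r : Fin σ.card) → (Fin (σ.arity r) → Fin n) → Fin (N n)) {p m q d : ℕ}
    {P : ∀ n, (Fin (N n) → Bool) → (Fin p → Fin n) → RecTuple i m q n → Prop}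
    (hP : Computes b i fun n (v : (Fin p → Fin n) × RecTuple i m q n) x => P n x v.1 v.2)
    (ψ : PosFormula σ p i m q d) :
    Computes b i fun n (s : Fin d → Fin n) x =>
      ψ.Realize (structAt (pos n) x) (P n x) s := by
  have hc (d : ℕ) : PolyCard fun n => Fin d → Fin n := PolyCard.fin.pi _
  induction ψ with
  | fo φ => exact computes_formula hb pos φ
  | atom v w => exact hP.reindex (fun n s => (s ∘ v, s ∘ w)) fun _ _ _ => Iff.rfl
  | and ψ₁ ψ₂ ih₁ ih₂ => exact ih₁.and (hc _) ih₂
  | or ψ₁ ψ₂ ih₁ ih₂ => exact ih₁.or (hc _) ih₂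
  | all ψ ih => exact ih.bigAnd hb (hc _) PolyCard.fin fun n s a => Fin.snoc s a
  | ex ψ ih => exact ih.bigOr hb (hc _) (hc _) PolyCard.fin fun n s a => Fin.snoc s a

theorem computes_gprFormula (hb : b = .bounded → 1 ≤ i)
    (pos : ∀ n, (r : Fin σ.card) → (Fin (σ.arity r) → Fin n) → Fin (N n)) {d : ℕ}
    (φ : GPRFormula σ i d) :
    Computes b i fun n (s : Fin d → Fin n) x => φ.Realize b (structAt (pos n) x) s := by
  have hc (d : ℕ) : PolyCard fun n => Fin d → Fin n := PolyCard.fin.pi _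
  induction φ with
  | fo φ => exact computes_formula hb pos φ
  | not φ ih => exact ih.not (hc _)
  | and φ₁ φ₂ ih₁ ih₂ => exact ih₁.and (hc _) ih₂
  | or φ₁ φ₂ ih₁ ih₂ => exact ih₁.or (hc _) ih₂
  | all φ ih => exact ih.bigAnd hb (hc _) PolyCard.fin fun n s a => Fin.snoc s a
  | ex φ ih => exact ih.bigOr hb (hc _) (hc _) PolyCard.fin fun n s a => Fin.snoc s a
  | gpr p m q hm θ ψ =>
    exact (computes_posFormula hb pos (computes_rel hb pos θ) ψ).reindex (fun _ s => s)
      fun n s x => θ.exists_defines_and b _ fun P => ψ.Realize (structAt (pos n) x) P s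

end Recursion

/-! ## From logic to circuits -/

/-- The languages decided by circuit families of polynomial size and of depth `O(log ^ i)`, with the
fan-in restriction that belongs to the mode. -/
def circuitClass (b : Mode) (i : ℕ) : Set (Set (List Bool)) :=
  {L | ∃ C : ∀ n : ℕ, Circuit n,
    PolySize C ∧ PolylogDepth i C ∧ (∀ n g, b.Admits ((C n).node g)) ∧ Decides C L}

theorem circuitClass_unbounded (i : ℕ) : circuitClass .unbounded i = AC i := by
  ext L
  exact exists_congr fun C => and_congr_right fun _ => and_congr_right fun _ =>
    ⟨fun h => h.2, fun h => ⟨fun _ _ => trivial, h⟩⟩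

theorem circuitClass_bounded (i : ℕ) : circuitClass .bounded i = NC i := rfl

theorem polySize_of_polyBdd {C : ∀ n, Circuit n} {s : ℕ → ℕ} (hs : PolyBdd s)
    (h : ∀ n, (C n).size ≤ s n) : PolySize C := by
  obtain ⟨K, hK⟩ := hs
  -- `n + 2 ≤ 3 * n` for `n ≥ 1`.
  refine ⟨K, IsBigO.of_bound (3 ^ K) ?_⟩
  filter_upwards [eventually_ge_atTop 1] with n hn
  rw [Real.norm_natCast, Real.norm_of_nonneg (by positivity), ← mul_pow]
  have h1 : (C n).size ≤ (3 * n) ^ K :=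
    ((h n).trans (hK n)).trans (Nat.pow_le_pow_left (by omega) K)
  exact_mod_cast h1

theorem polylogDepth_of_logBdd {i : ℕ} {C : ∀ n, Circuit n} {d : ℕ → ℕ} (hd : LogBdd i d)
    (h : ∀ n, (C n).depth ≤ d n) : PolylogDepth i C := by
  obtain ⟨K, hK⟩ := hd
  -- For `n ≥ 2` the added `1` is at most `Real.logb 2 n`, whence the factor `2` under the power.
  refine IsBigO.of_bound (K * 2 ^ i) ?_
  filter_upwards [eventually_ge_atTop 2] with n hn
  have hl : 1 ≤ Real.logb 2 n := by
    rw [Real.le_logb_iff_rpow_le (by norm_num) (by positivity)]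
    simpa using hn
  have hlog : (Nat.log 2 n : ℝ) ≤ Real.logb 2 n := by
    have := Real.natLog_le_logb n 2
    exact_mod_cast this
  rw [Real.norm_natCast, Real.norm_of_nonneg (by positivity), mul_assoc, ← mul_pow]
  calc ((C n).depth : ℝ) ≤ (K : ℝ) * ((Nat.log 2 n : ℝ) + 1) ^ i := by
        exact_mod_cast (h n).trans (hK n)
    _ ≤ _ := by
        gcongr
        linarith

/-! ### Encodings of structures as input words. -/

section Encoding

variable {σ : Vocabulary} {n : ℕ}

/-- The length of the encodings of structures of size `n`. -/
def Vocabulary.encodingLength (σ : Vocabulary) (n : ℕ) : ℕ := ∑ r, n ^ σ.arity r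

/-- The symbol of positive arity makes growth strict, so the length of a word determines the size of
the universe and is at least that size. -/
theorem Vocabulary.encodingLength_strictMono (σ : Vocabulary) : StrictMono σ.encodingLength := by
  obtain ⟨r, hr⟩ := σ.exists_pos
  intro n m hnm
  exact Finset.sum_lt_sum (fun r _ => Nat.pow_le_pow_left hnm.le _)
    ⟨r, Finset.mem_univ r, Nat.pow_lt_pow_left hnm hr.ne'⟩

theorem Struct.length_encode (A : Struct σ n) : A.encode.length = σ.encodingLength n := by
  simp [Struct.encode, List.length_flatMap, Vocabulary.encodingLength, Fin.sum_univ_def]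

theorem exists_lexTuple_eq {k : ℕ} (v : Fin k → Fin n) : ∃ l, lexTuple n k l = v := by
  refine ⟨finFunctionFinEquiv (v ∘ Fin.rev), ?_⟩
  funext t
  simp [lexTuple]

/-- Block lengths do not depend on the entries, so one position `p` serves all `f`. This uniformity
allows an input gate to be attached to an atomic fact. -/
theorem exists_getElem?_flatMap {R β : Type} (l : List R) (len : R → ℕ) {r : R} (hr : r ∈ l)
    (j : Fin (len r)) : ∃ p : ℕ, ∀ f : (r : R) → Fin (len r) → β,
      (l.flatMap fun r => List.ofFn (f r))[p]? = some (f r j) := by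
  induction l with
  | nil => simp at hr
  | cons r' l ih =>
    by_cases h : r = r'
    · subst h
      refine ⟨j, fun f => ?_⟩
      rw [List.flatMap_cons, List.getElem?_append_left (by simp)]
      simp
    · obtain ⟨p, hp⟩ := ih ((List.mem_cons.1 hr).resolve_left h)
      refine ⟨len r' + p, fun f => ?_⟩
      rw [List.flatMap_cons, List.getElem?_append_right (by simp)]
      simpa using hp f

theorem exists_position (σ : Vocabulary) (n : ℕ) (r : Fin σ.card) (v : Fin (σ.arity r) → Fin n) :
    ∃ p : Fin (σ.encodingLength n), ∀ A : Struct σ n,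
      A.encode.get (p.cast A.length_encode.symm) = A r v := by
  obtain ⟨l, rfl⟩ := exists_lexTuple_eq v
  obtain ⟨p, hp⟩ := exists_getElem?_flatMap (β := Bool) (List.finRange σ.card)
    (fun r => n ^ σ.arity r) (List.mem_finRange r) l
  have hp' (A : Struct σ n) : A.encode[p]? = some (A r (lexTuple n _ l)) :=
    hp fun r l => A r (lexTuple n (σ.arity r) l)
  have hlt : p < σ.encodingLength n := by
    have A : Struct σ n := fun _ _ => false
    rw [← A.length_encode]
    exact (List.getElem?_eq_some_iff.1 (hp' A)).1
  exact ⟨⟨p, hlt⟩, fun A => (List.getElem?_eq_some_iff.1 (hp' A)).2⟩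

/-- The position of an atomic fact in the encoding of a structure. -/
noncomputable def position (σ : Vocabulary) (n : ℕ) (r : Fin σ.card)
    (v : Fin (σ.arity r) → Fin n) : Fin (σ.encodingLength n) := (exists_position σ n r v).choose

theorem encode_injective : Function.Injective (Struct.encode : Struct σ n → List Bool) := by
  intro A B h
  funext r v
  rw [← (exists_position σ n r v).choose_spec A, ← (exists_position σ n r v).choose_spec B]
  simp [h]

/-- Reading off the atomic facts is a left inverse of encoding. Structures and words of this length
are equally numerous, so it is also a right inverse. -/
theorem encode_structAt (x : Fin (σ.encodingLength n) → Bool) :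
    (structAt (position σ n) x).encode = List.ofFn x := by
  let E : Struct σ n → Fin (σ.encodingLength n) → Bool :=
    fun A p => A.encode.get (p.cast A.length_encode.symm)
  have hE (A : Struct σ n) : structAt (position σ n) (E A) = A := by
    funext r v
    exact (exists_position σ n r v).choose_spec A
  have : Finite (Struct σ n) :=
    inferInstanceAs (Finite ((r : Fin σ.card) → (Fin (σ.arity r) → Fin n) → Bool))
  have hcard : Nat.card (Struct σ n) = 2 ^ σ.encodingLength n := by
    change Nat.card ((r : Fin σ.card) → (Fin (σ.arity r) → Fin n) → Bool) = _
    rw [Nat.card_pi]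
    simp [Vocabulary.encodingLength, Finset.prod_pow_eq_pow_sum]
  obtain ⟨A, rfl⟩ :=
    ((Function.LeftInverse.injective hE).bijective_of_nat_card_le (by simp [hcard])).surjective x
  rw [hE]
  refine List.ext_get (by simp [A.length_encode]) fun j h1 h2 => ?_
  simp [E]

end Encoding

theorem definableOver_subset (σ : Vocabulary) {b : Mode} {i : ℕ} (hb : b = .bounded → 1 ≤ i) :
    definableOver σ b i ⊆ circuitClass b i := by
  rintro L ⟨φ, rfl⟩
  obtain ⟨s, d, ⟨K, hs⟩, ⟨M, hd⟩, h⟩ := computes_gprFormula hb (position σ) φ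
  have hC : ∀ N, ∃ C : Circuit N, C.size ≤ (N + 2) ^ K ∧
      C.depth ≤ (M + 1) * (Nat.log 2 N + 1) ^ i ∧ (∀ g, b.Admits (C.node g)) ∧
      ∀ x, C.Accepts x ↔ List.ofFn x ∈ φ.language b := by
    intro N
    -- At a length that no encoding has, a constant gate rejects; the `M + 1` in the depth bound
    -- leaves room for it even if `M = 0`.
    by_cases hN : ∃ n, σ.encodingLength n = N
    · obtain ⟨n, rfl⟩ := hN
      have hn : n ≤ σ.encodingLength n := σ.encodingLength_strictMono.le_apply
      obtain ⟨C, h1, h2, h3, h4⟩ := ((h n).reindex (κ := Unit) (fun _ => Fin.elim0)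
        fun _ _ => Iff.rfl).exists_circuit
      refine ⟨C, (h1.trans (hs n)).trans (Nat.pow_le_pow_left (by omega) K),
        (h2.trans (hd n)).trans (Nat.mul_le_mul (Nat.le_succ M)
          (Nat.pow_le_pow_left (Nat.succ_le_succ (Nat.log_mono_right hn)) i)), h3,
        fun x => (h4 x).trans ⟨fun hx => ⟨n, _, (encode_structAt x).symm, hx⟩, ?_⟩⟩
      rintro ⟨n', A, hA, hφ⟩
      obtain rfl : n' = n := σ.encodingLength_strictMono.injective <| by
        rw [← A.length_encode, ← hA, List.length_ofFn]
      rwa [encode_injective ((encode_structAt x).trans hA)]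
    · obtain ⟨C, h1, h2, h3, h4⟩ := ((Comp.empty (b := b) (N := N) (ι := Empty)
        (F := fun _ _ => False)).layer (κ := Unit) (H := fun _ _ => False)
        (fun _ => .const false) (fun _ => b.admits_of_card_le (by simp [Node.preds]))
        (fun _ _ => by simp [Node.eval, Node.sem])).reindex (H := fun _ _ => False)
        Sum.inr (fun _ _ => Iff.rfl) |>.exists_circuit
      refine ⟨C, h1.trans ?_, h2.trans ?_, h3, fun x => (h4 x).trans ⟨False.elim, ?_⟩⟩
      · simpa using Nat.one_le_pow K (N + 2) (by omega)
      · exact Nat.mul_pos (Nat.succ_pos M) (Nat.pow_pos (Nat.succ_pos _))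
      · rintro ⟨n, A, hA, -⟩
        exact hN ⟨n, by rw [← A.length_encode, ← hA, List.length_ofFn]⟩
  choose C h1 h2 h3 h4 using hC
  refine ⟨C, polySize_of_polyBdd ⟨K, fun _ => le_rfl⟩ h1,
    polylogDepth_of_logBdd ⟨M + 1, fun _ => le_rfl⟩ h2, h3, fun w => ?_⟩
  rw [h4, List.ofFn_get]

/-! ## Circuits as recursive programs -/

namespace Node

variable {n : ℕ} {G : Type}

/-- The truth value whose attainment by the predecessors decides whether a gate attains `b`. -/
def railSign : Node n G → Bool → Bool
  | .not _, b => !b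
  | _, b => b

/-- A gate attains the value `b` if some predecessor attains the value `railSign`. -/
def RailEx : Node n G → Bool → Prop
  | .not _, _ => True
  | .and _, b => b = false
  | .or _, b => b = true
  | _, _ => False

/-- A gate attains the value `b` if all predecessors attain the value `railSign`. -/
def RailAll : Node n G → Bool → Prop
  | .and _, b => b = true
  | .or _, b => b = false
  | _, _ => False

/-- This is De Morgan's law on two rails. The only negation left is the flip of the expected value
at a `not` gate, so the relation that records attained values occurs positively. -/
theorem eval_iff_rail (x : Fin n → Bool) (a : Node n G) (v : G → Prop) (b : Bool) :
    (a.eval x v ↔ b = true) ↔ a = .const b ∨ (∃ j, a = .input j ∧ x j = b) ∨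
      (a.RailEx b ∧ ∃ u ∈ a.preds, (v u ↔ a.railSign b = true)) ∨
      (a.RailAll b ∧ ∀ u ∈ a.preds, (v u ↔ a.railSign b = true)) := by
  cases a <;> cases b <;> simp [eval, sem, RailEx, RailAll, railSign, preds]

end Node

/-- The numerical data of a recursion that evaluates circuits, with two tuples for each gate, one
for each truth value that the gate may attain.  The first variable of the block `y_{i+1}` holds the
position of an input bit. -/
structure Program (i m q : ℕ) where
  /-- constants with the expected value -/
  const : ∀ n, RecTuple i m (q + 1) n → Prop
  /-- inputs that are expected to be `1` -/
  pos : ∀ n, RecTuple i m (q + 1) n → Prop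
  /-- inputs that are expected to be `0` -/
  neg : ∀ n, RecTuple i m (q + 1) n → Prop
  /-- disjunctive steps -/
  ex : ∀ n, RecTuple i m (q + 1) n → Prop
  /-- conjunctive steps -/
  all : ∀ n, RecTuple i m (q + 1) n → Prop
  /-- the wires -/
  succ : ∀ n, RecTuple i m (q + 1) n → RecTuple i m (q + 1) n → Prop
  /-- the output gate -/
  out : ∀ n, RecTuple i m (q + 1) n → Prop

/-- One round of the evaluation of a program. -/
def Program.Step {i m q n : ℕ} (p : Program i m q) (f : Fin n → Bool)
    (P : RecTuple i m (q + 1) n → Prop) (y : RecTuple i m (q + 1) n) : Prop :=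
  (p.const n y ∨ (p.pos n y ∧ f (y (.inr 0)) = true) ∨
    (p.neg n y ∧ ¬ f (y (.inr 0)) = true)) ∨
  (p.ex n y ∧ ∃ z, p.succ n y z ∧ P z) ∨ (p.all n y ∧ ∀ z, p.succ n y z → P z)

/-! ### Explicit size and depth bounds, and codes for gates. -/

theorem exists_nat_bound {u : ℕ → ℕ} {v : ℕ → ℝ}
    (h : (fun n => (u n : ℝ)) =O[atTop] v) :
    ∃ c : ℕ, ∀ n, v n ≠ 0 → (u n : ℝ) ≤ c * ‖v n‖ := by
  obtain ⟨c, -, hc⟩ := bound_of_isBigO_nat_atTop h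
  refine ⟨⌈c⌉₊, fun n hn => ?_⟩
  have := hc hn
  rw [Real.norm_natCast] at this
  exact this.trans (mul_le_mul_of_nonneg_right (Nat.le_ceil c) (norm_nonneg _))

/-- The factor `2` accounts for the two rails. For `n ≥ 2` the constant is absorbed through `2 * c ≤
n ^ (2 * c)`; shorter words are handled separately by `shortWords`. -/
theorem PolySize.exists_bound {C : ∀ n, Circuit n} (h : PolySize C) :
    ∃ K : ℕ, ∀ n, 2 ≤ n → 2 * (C n).size ≤ n ^ K := by
  obtain ⟨k, hk⟩ := h
  obtain ⟨c, hc⟩ := exists_nat_bound hk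
  refine ⟨2 * c + k, fun n hn => ?_⟩
  have h1 := hc n (pow_ne_zero k (by positivity))
  rw [Real.norm_of_nonneg (by positivity)] at h1
  have h2 : (C n).size ≤ c * n ^ k := by exact_mod_cast h1
  have h3 : 2 * c ≤ n ^ (2 * c) :=
    Nat.lt_two_pow_self.le.trans (Nat.pow_le_pow_left hn (2 * c))
  rw [pow_add]
  nlinarith [Nat.mul_le_mul_right (n ^ k) h3]

theorem PolylogDepth.exists_bound {i : ℕ} {C : ∀ n, Circuit n} (h : PolylogDepth i C) :
    ∃ c : ℕ, ∀ n, 2 ≤ n → (C n).depth ≤ c * (2 * Nat.log 2 n) ^ i := by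
  obtain ⟨c, hc⟩ := exists_nat_bound h
  refine ⟨c, fun n hn => ?_⟩
  have hn' : (2 : ℝ) ≤ n := by exact_mod_cast hn
  have hpos : 0 < Real.logb 2 n := Real.logb_pos (by norm_num) (by linarith)
  have hlog : Real.logb 2 n ≤ 2 * Nat.log 2 n := by
    have h1 : 1 ≤ Nat.log 2 n := Nat.log_pos (by norm_num) hn
    have h2 : Real.logb 2 n ≤ (Nat.log 2 n + 1 : ℕ) := by
      rw [Real.logb_le_iff_le_rpow (by norm_num) (by linarith), Real.rpow_natCast]
      exact_mod_cast (Nat.lt_pow_succ_log_self (b := 2) (by norm_num) n).le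
    refine h2.trans ?_
    exact_mod_cast (by omega : Nat.log 2 n + 1 ≤ 2 * Nat.log 2 n)
  have h1 := hc n (pow_ne_zero i hpos.ne')
  rw [Real.norm_of_nonneg (by positivity)] at h1
  have h2 : ((C n).depth : ℝ) ≤ c * (2 * Nat.log 2 n) ^ i :=
    h1.trans (mul_le_mul_of_nonneg_left (pow_le_pow_left₀ hpos.le hlog i) (by positivity))
  exact_mod_cast h2

theorem Circuit.gateDepth_le_depth {n : ℕ} (C : Circuit n) (g : C.G) : C.gateDepth g ≤ C.depth :=
  Finset.le_sup (f := C.gateDepth) (@Finset.mem_univ _ C.fin g)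

theorem Circuit.gateDepth_lt {n : ℕ} (C : Circuit n) {g u : C.G} (h : u ∈ (C.node g).preds) :
    C.gateDepth u < C.gateDepth g := by
  rw [C.gateDepth_eq g]
  exact Finset.le_sup (f := fun u => C.gateDepth u + 1) h

/-- Depths below `B ^ i` are represented by `i` numbers below `2 ^ B` in such a way that
decreasing depth is guarded. -/
theorem exists_halving_code (i : ℕ) {B n m : ℕ} (hB : 2 ^ B ≤ n ^ m) :
    ∃ Y : Fin (B ^ i) → Fin i → Fin m → Fin n, ∀ s t, s < t → ∃ j,
      (0 < tupleValue (Y t j) ∧ 2 * tupleValue (Y s j) ≤ tupleValue (Y t j)) ∧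
        ∀ k < j, tupleValue (Y s k) ≤ tupleValue (Y t k) := by
  -- For `d < e` one has `2 * (2 ^ d - 1) ≤ 2 ^ e - 1` and `0 < 2 ^ e - 1`: a smaller digit becomes
  -- a proper halving.
  have h (d : Fin B) : ∃ t : Fin m → Fin n, tupleValue t = 2 ^ (d : ℕ) - 1 := by
    refine exists_tupleValue_eq (lt_of_lt_of_le ?_ hB)
    have := Nat.pow_lt_pow_right (a := 2) (by norm_num) d.2
    have : 1 ≤ 2 ^ (d : ℕ) := Nat.one_le_two_pow
    omega
  choose Z hZ using h
  refine ⟨fun t j => Z (ofLex (lexOrderIso i B t) j), fun s t hst => ?_⟩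
  obtain ⟨j, heq, hlt⟩ := (lexOrderIso i B).lt_iff_lt.2 hst
  refine ⟨j, ?_, fun k hk => ?_⟩
  · have hlt' : (ofLex (lexOrderIso i B s) j : ℕ) < ofLex (lexOrderIso i B t) j := hlt
    have h1 := Nat.pow_le_pow_right (n := 2) (by norm_num) (Nat.succ_le_of_lt hlt')
    have h2 : 1 ≤ 2 ^ (ofLex (lexOrderIso i B s) j : ℕ) := Nat.one_le_two_pow
    rw [Nat.succ_eq_add_one, pow_succ] at h1
    rw [hZ, hZ]
    omega
  · have : ofLex (lexOrderIso i B s) k = ofLex (lexOrderIso i B t) k := heq k hk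
    exact (congrArg (fun d => tupleValue (Z d)) this).le

theorem exists_depth_code {i : ℕ} (hi : 1 ≤ i) {C : ∀ n, Circuit n} (h : PolylogDepth i C) :
    ∃ m, 0 < m ∧ ∀ n, 2 ≤ n → ∃ Y : (C n).G → Fin i → Fin m → Fin n,
      ∀ g, ∀ u ∈ ((C n).node g).preds, ∃ j,
        (0 < tupleValue (Y g j) ∧ 2 * tupleValue (Y u j) ≤ tupleValue (Y g j)) ∧
          ∀ k < j, tupleValue (Y u k) ≤ tupleValue (Y g k) := by
  obtain ⟨c, hc⟩ := h.exists_bound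
  -- With `m = 2 * (c + 1)` and `B = m * log n`, `B`-bit numbers fit into a block, and `B ^ i = (c +
  -- 1) ^ i * (2 * log n) ^ i` exceeds the depth since `1 ≤ i`.
  refine ⟨2 * (c + 1), by omega, fun n hn => ?_⟩
  have hl : 1 ≤ Nat.log 2 n := Nat.log_pos (by norm_num) hn
  obtain ⟨Y, hY⟩ := exists_halving_code i (B := Nat.log 2 n * (2 * (c + 1))) (n := n)
    (m := 2 * (c + 1)) (by
      rw [pow_mul]
      exact Nat.pow_le_pow_left (Nat.pow_log_le_self 2 (by omega)) _)
  have hlt (g : (C n).G) : (C n).gateDepth g < (Nat.log 2 n * (2 * (c + 1))) ^ i := by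
    refine (((C n).gateDepth_le_depth g).trans (hc n hn)).trans_lt ?_
    rw [show Nat.log 2 n * (2 * (c + 1)) = (c + 1) * (2 * Nat.log 2 n) by ring,
      mul_pow (c + 1)]
    refine Nat.mul_lt_mul_of_pos_right ?_ (Nat.pow_pos (Nat.mul_pos two_pos hl))
    exact (Nat.lt_succ_self c).trans_le (Nat.le_self_pow (by omega) (c + 1))
  exact ⟨fun g => Y ⟨_, hlt g⟩, fun g u hu => hY _ _ ((C n).gateDepth_lt hu)⟩

/-- The blocks `y_1, ..., y_i` hold the depth. The last block holds an input position followed by a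
name for the pair of gate and truth value, and this name alone gives injectivity. -/
theorem exists_code {i : ℕ} {C : ∀ n, Circuit n} (hs : PolySize C) (hd : PolylogDepth i C) :
    ∃ m q, 0 < m ∧ ∀ n, 2 ≤ n → ∃ code : (C n).G × Bool → RecTuple i m (q + 1) n,
      Function.Injective code ∧
      (∀ g b j, (C n).node g = .input j → code (g, b) (.inr 0) = j) ∧
      (1 ≤ i → ∀ g, ∀ u ∈ ((C n).node g).preds, ∀ b b', Guard (code (g, b)) (code (u, b'))) := by
  classical
  obtain ⟨q, hq⟩ := hs.exists_bound
  have hY : ∃ m, 0 < m ∧ ∀ n, 2 ≤ n → ∃ Y : (C n).G → Fin i → Fin m → Fin n, 1 ≤ i →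
      ∀ g, ∀ u ∈ ((C n).node g).preds, ∃ j,
        (0 < tupleValue (Y g j) ∧ 2 * tupleValue (Y u j) ≤ tupleValue (Y g j)) ∧
          ∀ k < j, tupleValue (Y u k) ≤ tupleValue (Y g k) := by
    rcases Nat.eq_zero_or_pos i with rfl | hi
    · exact ⟨1, one_pos, fun n hn => ⟨fun _ j => j.elim0, fun h => absurd h (by norm_num)⟩⟩
    · obtain ⟨m, hm, h⟩ := exists_depth_code hi hd
      refine ⟨m, hm, fun n hn => ?_⟩
      obtain ⟨Y, hY⟩ := h n hn
      exact ⟨Y, fun _ => hY⟩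
  obtain ⟨m, hm, hY⟩ := hY
  refine ⟨m, q, hm, fun n hn => ?_⟩
  obtain ⟨Y, hY⟩ := hY n hn
  let _ : Fintype (C n).G := (C n).fin
  have hcard : Fintype.card ((C n).G × Bool) ≤ Fintype.card (Fin q → Fin n) := by
    rw [Fintype.card_prod, Fintype.card_bool, mul_comm, Fintype.card_fun, Fintype.card_fin,
      Fintype.card_fin]
    exact hq n hn
  obtain ⟨Z⟩ := Function.Embedding.nonempty_of_card_le hcard
  -- The entry `0` at other gates is arbitrary.
  let dg : Node n (C n).G → Fin n
    | .input j => j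
    | _ => ⟨0, by omega⟩
  refine ⟨fun gb => Sum.elim (fun jk => Y gb.1 jk.1 jk.2)
    (Fin.cons (dg ((C n).node gb.1)) (Z gb) : Fin (q + 1) → Fin n), ?_, ?_, ?_⟩
  · intro gb gb' h
    refine Z.injective (funext fun k => ?_)
    simpa using congrFun h (.inr k.succ)
  · intro g b j hj
    simp [hj, dg]
  · exact fun hi g u hu _ _ => hY hi g u hu

/-- Treating length and letters as one dependent pair avoids a cast along `(List.ofFn f).length =
n`. -/
theorem decides_ofFn {C : ∀ n, Circuit n} {L : Set (List Bool)} (h : Decides C L) {n : ℕ}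
    (f : Fin n → Bool) : List.ofFn f ∈ L ↔ (C n).Accepts f := by
  rw [h]
  have := List.equivSigmaTuple.right_inv ⟨n, f⟩
  exact iff_of_eq (congrArg (fun p : Σ n, Fin n → Bool => (C p.1).Accepts p.2) this)

/-- Every circuit family of the given size and depth is evaluated by a program whose wires are
guarded. -/
theorem exists_program {b : Mode} {i : ℕ} {L : Set (List Bool)} (hL : L ∈ circuitClass b i) :
    ∃ (m q : ℕ) (_ : 0 < m) (p : Program i m q) (D : ℕ → ℕ),
      (1 ≤ i → ∀ n y z, p.succ n y z → Guard y z) ∧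
      (b = .bounded → ∀ n y u v w, p.succ n y u → p.succ n y v → p.succ n y w →
        u = v ∨ u = w ∨ v = w) ∧
      (i = 0 → ∀ n, D n = D 0) ∧
      -- The sequence `P` covers two uses: the successive unfoldings for `i = 0`, and the constant
      -- sequence at the relation defined by the recursion for `i ≥ 1`.
      ∀ n (f : Fin n → Bool) (P : ℕ → RecTuple i m (q + 1) n → Prop),
        (∀ t y, P (t + 1) y ↔ p.Step f (P t) y) →
          ((∃ y, p.out n y ∧ P (D n) y) ↔ 2 ≤ n ∧ List.ofFn f ∈ L) := by
  obtain ⟨C, hs, hd, hadm, hdec⟩ := hL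
  obtain ⟨m, q, hm, hcode⟩ := exists_code hs hd
  choose code hinj hpos hguard using hcode
  obtain ⟨c, hc⟩ := hd.exists_bound
  have hcode_iff (n h) (g g' : (C n).G) (b b') :
      code n h (g, b) = code n h (g', b') ↔ g = g' ∧ b = b' := by
    rw [(hinj n h).eq_iff, Prod.mk.injEq]
  refine ⟨m, q, hm,
    { const := fun n y => ∃ h g b, code n h (g, b) = y ∧ (C n).node g = .const b
      pos := fun n y => ∃ h g j, code n h (g, true) = y ∧ (C n).node g = .input j
      neg := fun n y => ∃ h g j, code n h (g, false) = y ∧ (C n).node g = .input j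
      ex := fun n y => ∃ h g b, code n h (g, b) = y ∧ ((C n).node g).RailEx b
      all := fun n y => ∃ h g b, code n h (g, b) = y ∧ ((C n).node g).RailAll b
      succ := fun n y z => ∃ h g b, code n h (g, b) = y ∧ ∃ u ∈ ((C n).node g).preds,
        code n h (u, ((C n).node g).railSign b) = z
      out := fun n y => ∃ h, code n h ((C n).out, true) = y },
    -- The value at a gate is correct once the number of rounds exceeds its depth, hence `+ 1`. For
    -- `i = 0` this is the constant `c + 1`.
    fun n => c * (2 * Nat.log 2 n) ^ i + 1, ?_, ?_, ?_, ?_⟩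
  · rintro hi n y z ⟨h, g, b, rfl, u, hu, rfl⟩
    exact hguard n h hi g u hu _ _
  · rintro rfl n y x₁ x₂ x₃ ⟨h, g, b, rfl, u, hu, rfl⟩ ⟨_, g', b', h', u', hu', rfl⟩
      ⟨_, g'', b'', h'', u'', hu'', rfl⟩
    obtain ⟨rfl, rfl⟩ := (hcode_iff _ _ _ _ _ _).1 h'
    obtain ⟨rfl, rfl⟩ := (hcode_iff _ _ _ _ _ _).1 h''
    simp only [hcode_iff, and_true]
    by_contra! hne
    -- The rail of a successor is determined by the gate, so three distinct successors would come
    -- from three distinct predecessors.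
    have h3 : 2 < ((C n).node g'').preds.card :=
      Finset.two_lt_card.2 ⟨u, hu, u', hu', u'', hu'', hne.1, hne.2.1, hne.2.2⟩
    exact absurd (hadm n g'') (not_le.2 h3)
  · rintro rfl n
    simp
  · intro n f P hP
    by_cases hn : 2 ≤ n
    swap
    · exact ⟨fun ⟨y, ⟨h, _⟩, _⟩ => absurd h hn, fun h => absurd h.1 hn⟩
    have key : ∀ t g, (C n).gateDepth g < t → ∀ b,
        (P t (code n hn (g, b)) ↔ ((C n).value f g ↔ b = true)) := by
      intro t
      induction t with
      | zero => exact fun g hg => absurd hg (Nat.not_lt_zero _)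
      | succ t ih =>
        intro g hg b
        have ih' : ∀ u ∈ ((C n).node g).preds, ∀ b,
            (P t (code n hn (u, b)) ↔ ((C n).value f u ↔ b = true)) :=
          fun u hu => ih u (by have := (C n).gateDepth_lt hu; omega)
        have hval : (C n).value f g ↔ ((C n).node g).eval f ((C n).value f) :=
          iff_of_eq ((C n).value_eq f g)
        rw [hP, hval, Node.eval_iff_rail, Program.Step]
        have e1 : ∀ b' : Bool, (∃ (h : 2 ≤ n) (g' : (C n).G) (j : Fin n),
            code n h (g', b') = code n hn (g, b) ∧ (C n).node g' = .input j) ↔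
            b' = b ∧ ∃ j, (C n).node g = .input j := by
          intro b'
          constructor
          · rintro ⟨_, g', j, h, hj⟩
            obtain ⟨rfl, rfl⟩ := (hcode_iff _ _ _ _ _ _).1 h
            exact ⟨rfl, j, hj⟩
          · rintro ⟨rfl, j, hj⟩
            exact ⟨hn, g, j, rfl, hj⟩
        have e2 : ∀ Q : (C n).G → Bool → Prop, (∃ (_ : 2 ≤ n) (g' : (C n).G) (b' : Bool),
            code n hn (g', b') = code n hn (g, b) ∧ Q g' b') ↔ Q g b := by
          intro Q
          constructor
          · rintro ⟨_, g', b', h, hQ⟩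
            obtain ⟨rfl, rfl⟩ := (hcode_iff _ _ _ _ _ _).1 h
            exact hQ
          · exact fun hQ => ⟨hn, g, b, rfl, hQ⟩
        simp only [e1]
        rw [e2 fun g b => (C n).node g = .const b, e2 fun g b => ((C n).node g).RailEx b,
          e2 fun g b => ((C n).node g).RailAll b]
        simp only [e2 fun g b => ∃ u ∈ ((C n).node g).preds,
          code n hn (u, ((C n).node g).railSign b) = _]
        rw [or_assoc]
        refine or_congr Iff.rfl (or_congr ?_ (or_congr ?_ ?_))
        · by_cases hj : ∃ j, (C n).node g = .input j
          · obtain ⟨j, hj⟩ := hj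
            rw [hpos n hn g b j hj]
            cases b <;> simp [hj]
          · have hj' : ∀ j, (C n).node g ≠ .input j := not_exists.1 hj
            simp [hj']
        · refine and_congr_right fun _ => ?_
          constructor
          · rintro ⟨_, ⟨u, hu, rfl⟩, hPu⟩
            exact ⟨u, hu, (ih' u hu _).1 hPu⟩
          · rintro ⟨u, hu, h⟩
            exact ⟨_, ⟨u, hu, rfl⟩, (ih' u hu _).2 h⟩
        · refine and_congr_right fun _ => ?_
          constructor
          · exact fun h u hu => (ih' u hu _).1 (h _ ⟨u, hu, rfl⟩)
          · rintro h _ ⟨u, hu, rfl⟩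
            exact (ih' u hu _).2 (h u hu)
    have hout := key _ (C n).out
      (Nat.lt_succ_of_le (((C n).gateDepth_le_depth _).trans (hc n hn))) true
    rw [decides_ofFn hdec]
    refine Iff.trans ?_ (and_iff_right hn).symm
    refine Iff.trans ?_ (hout.trans (iff_true_right rfl))
    constructor
    · rintro ⟨_, ⟨_, rfl⟩, h⟩
      exact h
    · exact fun h => ⟨_, ⟨hn, rfl⟩, h⟩

/-! ## From circuits to logic -/

section Formulas

variable {n : ℕ}

/-- A numerical predicate as a formula of FO[Arb]. -/
noncomputable def arbAtom (σ : Vocabulary) {α : Type} [Finite α]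
    (Q : ∀ n, (α → Fin n) → Prop) : (arbLanguage σ).Formula α :=
  FirstOrder.Language.Relations.formula (L := arbLanguage σ) (n := Nat.card α)
    (RelSymbol.numerical fun n v => Q n (v ∘ Finite.equivFin α))
    fun k => .var ((Finite.equivFin α).symm k)

theorem realize_arbAtom {σ : Vocabulary} (A : Struct σ n) {α : Type} [Finite α]
    (Q : ∀ n, (α → Fin n) → Prop) (v : α → Fin n) :
    @FirstOrder.Language.Formula.Realize _ _ A.toStructure _ (arbAtom σ Q) v ↔ Q n v := by
  let _ := A.toStructure
  refine FirstOrder.Language.Formula.realize_rel.trans ?_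
  change Q n ((fun k => v ((Finite.equivFin α).symm k)) ∘ Finite.equivFin α) ↔ _
  simp [Function.comp_def]

/-- A numerical predicate as a formula without symbols for the input structure. -/
noncomputable def numAtom {α : Type} [Finite α] (Q : ∀ n, (α → Fin n) → Prop) :
    numLanguage.Formula α :=
  FirstOrder.Language.Relations.formula (L := numLanguage) (n := Nat.card α)
    (fun n v => Q n (v ∘ Finite.equivFin α)) fun k => .var ((Finite.equivFin α).symm k)

theorem realize_numAtom {α : Type} [Finite α] (Q : ∀ n, (α → Fin n) → Prop) (v : α → Fin n) :
    (numAtom Q).Realize v ↔ Q n v := by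
  refine FirstOrder.Language.Formula.realize_rel.trans ?_
  change Q n ((fun k => v ((Finite.equivFin α).symm k)) ∘ Finite.equivFin α) ↔ _
  simp [Function.comp_def]

/-- The relation symbol of the vocabulary of words. -/
def letter : Fin wordVocabulary.card := (0 : Fin 1)

/-- A word as a structure. -/
def wordStruct (f : Fin n → Bool) : Struct wordVocabulary n := fun _ v => f (v (0 : Fin 1))

theorem encode_wordStruct (f : Fin n → Bool) : (wordStruct f).encode = List.ofFn f := by
  refine List.ext_getElem ?_ fun j h1 h2 => ?_
  · rw [Struct.length_encode]
    change ∑ _ : Fin 1, n ^ 1 = _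
    simp
  · have e : (wordStruct f).encode =
        List.ofFn fun l => wordStruct f letter (lexTuple n 1 l) :=
      List.append_nil _
    simp only [e, List.getElem_ofFn]
    refine congrArg f (Fin.ext ?_)
    change ((finFunctionFinEquiv.symm _ : Fin 1 → Fin n) _ : ℕ) = j
    rw [finFunctionFinEquiv_symm_apply_val]
    rw [List.length_ofFn] at h2
    simp [Nat.mod_eq_of_lt h2]

/-- A sentence over the vocabulary of words defines `L` if it holds in exactly the words in `L`. -/
theorem mem_definableOver_word {b : Mode} {i : ℕ} {L : Set (List Bool)}
    (φ : GPRFormula wordVocabulary i 0)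
    (h : ∀ n (f : Fin n → Bool), φ.Realize b (wordStruct f) Fin.elim0 ↔ List.ofFn f ∈ L) :
    L ∈ definableOver wordVocabulary b i := by
  refine ⟨φ, Set.ext fun w => ⟨fun hw => ?_, ?_⟩⟩
  · refine ⟨w.length, wordStruct w.get, ?_, (h _ _).2 ?_⟩
    · rw [encode_wordStruct, List.ofFn_get]
    · rwa [List.ofFn_get]
  · rintro ⟨n, A, rfl, hA⟩
    have e : A = wordStruct fun a => A letter fun _ => a := by
      funext r v
      obtain rfl : r = letter := Subsingleton.elim (α := Fin 1) _ _
      refine congrArg (A letter) (funext fun t => congrArg v (Subsingleton.elim (α := Fin 1) _ _))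
    rw [e] at hA ⊢
    rw [encode_wordStruct]
    exact (h _ _).1 hA

/-- The letter at position `a` is `1`. -/
def letterAtom {α : Type} (a : α) : (arbLanguage wordVocabulary).Formula α :=
  FirstOrder.Language.Relations.formula (L := arbLanguage wordVocabulary) (n := 1)
    (RelSymbol.input (σ := wordVocabulary) letter) fun _ => .var a

/-- The formula `Q₀ ∨ (Q₁ ∧ the letter at a is 1) ∨ (Q₂ ∧ the letter at a is not 1)`. -/
noncomputable def literalFormula {α : Type} [Finite α] (a : α)
    (Q₀ Q₁ Q₂ : ∀ n, (α → Fin n) → Prop) : (arbLanguage wordVocabulary).Formula α :=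
  arbAtom _ Q₀ ⊔ ((arbAtom _ Q₁ ⊓ letterAtom a) ⊔ (arbAtom _ Q₂ ⊓ (letterAtom a).not))

theorem realize_literalFormula {α : Type} [Finite α] (a : α)
    (Q₀ Q₁ Q₂ : ∀ n, (α → Fin n) → Prop) (f : Fin n → Bool) (v : α → Fin n) :
    @FirstOrder.Language.Formula.Realize _ _ (wordStruct f).toStructure _
      (literalFormula a Q₀ Q₁ Q₂) v ↔
      Q₀ n v ∨ (Q₁ n v ∧ f (v a) = true) ∨ (Q₂ n v ∧ ¬ f (v a) = true) := by
  let _ := (wordStruct f).toStructure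
  have h : (letterAtom a).Realize v ↔ f (v a) = true :=
    FirstOrder.Language.Formula.realize_rel.trans Iff.rfl
  simp only [literalFormula, FirstOrder.Language.Formula.realize_sup,
    FirstOrder.Language.Formula.realize_inf, FirstOrder.Language.Formula.realize_not, h,
    realize_arbAtom]

/-- Existential closure of a positive formula. -/
def PosFormula.exs {σ : Vocabulary} {p i m q : ℕ} :
    {d : ℕ} → PosFormula σ p i m q d → PosFormula σ p i m q 0
  | 0, ψ => ψ
  | _ + 1, ψ => ψ.ex.exs

theorem PosFormula.realize_exs {σ : Vocabulary} {p i m q : ℕ} (A : Struct σ n)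
    (P : (Fin p → Fin n) → RecTuple i m q n → Prop) :
    ∀ {d : ℕ} (ψ : PosFormula σ p i m q d),
      ψ.exs.Realize A P Fin.elim0 ↔ ∃ s, ψ.Realize A P s
  | 0, ψ => ⟨fun h => ⟨_, h⟩, fun ⟨s, h⟩ => by rwa [Subsingleton.elim s Fin.elim0] at h⟩
  | d + 1, ψ => by
    refine (PosFormula.realize_exs A P ψ.ex).trans ⟨?_, ?_⟩
    · rintro ⟨s, a, h⟩
      exact ⟨_, h⟩
    · rintro ⟨s, h⟩
      refine ⟨Fin.init s, s (Fin.last d), ?_⟩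
      rwa [Fin.snoc_init_self]

/-- A sentence for the words of length less than `2` in `L`. -/
noncomputable def shortWords (L : Set (List Bool)) (i : ℕ) : GPRFormula wordVocabulary i 0 :=
  .or (.fo (arbAtom _ fun n _ => n = 0 ∧ [] ∈ L))
    (.ex (.fo (literalFormula 0 (fun _ _ => False) (fun n _ => n = 1 ∧ [true] ∈ L)
      fun n _ => n = 1 ∧ [false] ∈ L)))

theorem realize_shortWords (b : Mode) (L : Set (List Bool)) (i : ℕ) (f : Fin n → Bool) :
    (shortWords L i).Realize b (wordStruct f) Fin.elim0 ↔ n < 2 ∧ List.ofFn f ∈ L := by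
  refine (or_congr (realize_arbAtom _ _ _) (exists_congr fun a =>
    realize_literalFormula _ _ _ _ f _)).trans ?_
  match n, f with
  | 0, f => simp
  | 1, f =>
    have : ∀ a : Fin 1, f ((Fin.snoc Fin.elim0 a : Fin 1 → Fin 1) 0) = f 0 :=
      fun a => congrArg f (Subsingleton.elim _ _)
    simp only [this, List.ofFn_succ, List.ofFn_zero]
    cases f 0 <;> simp
  | n + 2, f => simp

end Formulas

/-! ### Formulas that run a program. -/

namespace Program

variable {i m q : ℕ} (p : Program i m q)

/-- The body of the recursion that runs a program. -/
noncomputable def body : Body wordVocabulary 0 i m (q + 1) 0 :=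
  .or (.fo (literalFormula (.inr (.inl (.inr 0)))
      (fun n v => p.const n fun r => v (.inr (.inl r)))
      (fun n v => p.pos n fun r => v (.inr (.inl r)))
      fun n v => p.neg n fun r => v (.inr (.inl r))))
    (.or
      (.and (.fo (arbAtom _ fun n v => p.ex n fun r => v (.inr (.inl r))))
        (.ex (numAtom fun n v => p.succ n (v ∘ .inl) (v ∘ .inr)) (.call 0)))
      (.and (.fo (arbAtom _ fun n v => p.all n fun r => v (.inr (.inl r))))
        (.all (numAtom fun n v => p.succ n (v ∘ .inl) (v ∘ .inr)) (.call 0))))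

/-- Wires already satisfy the guard, and in bounded mode there are at most two per tuple, so
relativization loses nothing and one body serves both modes. -/
theorem realize_body {b : Mode} (hguard : ∀ n y z, p.succ n y z → Guard y z)
    (htwo : b = .bounded → ∀ n y u v w, p.succ n y u → p.succ n y v → p.succ n y w →
      u = v ∨ u = w ∨ v = w) {n : ℕ} (f : Fin n → Bool)
    (P : (Fin 0 → Fin n) → RecTuple i m (q + 1) n → Prop) (x : Fin 0 → Fin n)
    (y : RecTuple i m (q + 1) n) :
    p.body.Realize b (wordStruct f) P x y Fin.elim0 ↔ p.Step f (P x) y := by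
  have hset : GuardSet (numAtom fun n v => p.succ n (v ∘ .inl) (v ∘ .inr)) y = p.succ n y := by
    funext z
    refine propext ((and_congr_right fun _ => realize_numAtom _ _).trans ?_)
    exact and_iff_right_of_imp (hguard n y z)
  have hrange (z) : b.Range (p.succ n y) z ↔ p.succ n y z :=
    b.range_iff_of_card_le (fun hb => htwo hb n y) z
  have hsnoc (z : RecTuple i m (q + 1) n) :
      (Fin.snoc Fin.elim0 z : Fin 1 → RecTuple i m (q + 1) n) 0 = z := rfl
  simp only [body, Body.Realize, realize_literalFormula, realize_arbAtom, hset, hrange, hsnoc,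
    Step, Sum.elim_inr, Sum.elim_inl]

/-- The formula that is satisfied by the output tuple if the recursion holds there. -/
noncomputable def accept : PosFormula wordVocabulary 0 i m (q + 1) 0 :=
  PosFormula.exs (d := Nat.card (RecVar i m (q + 1)))
    (.and (.fo (arbAtom _ fun n s => p.out n (s ∘ Finite.equivFin _)))
      (.atom Fin.elim0 (Finite.equivFin _)))

theorem realize_accept {n : ℕ} (A : Struct wordVocabulary n)
    (P : (Fin 0 → Fin n) → RecTuple i m (q + 1) n → Prop) :
    p.accept.Realize A P Fin.elim0 ↔ ∃ y, p.out n y ∧ P Fin.elim0 y := by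
  rw [accept, PosFormula.realize_exs]
  refine (exists_congr fun s => and_congr_left fun _ => realize_arbAtom A _ s).trans ?_
  constructor
  · rintro ⟨s, h1, h2⟩
    refine ⟨_, h1, ?_⟩
    change P (s ∘ Fin.elim0) _ at h2
    rwa [Subsingleton.elim (s ∘ Fin.elim0) Fin.elim0] at h2
  · rintro ⟨y, h1, h2⟩
    refine ⟨y ∘ (Finite.equivFin _).symm, ?_⟩
    have e : (y ∘ (Finite.equivFin _).symm) ∘ Finite.equivFin _ = y := by
      funext r
      simp
    change _ ∧ P (_ ∘ Fin.elim0) _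
    rw [e, Subsingleton.elim (_ ∘ Fin.elim0) Fin.elim0]
    exact ⟨h1, h2⟩

/-- The formula that describes `t` rounds of a program. -/
noncomputable def rounds : ℕ → (arbLanguage wordVocabulary).Formula (RecVar i m (q + 1))
  | 0 => ⊥
  | t + 1 => literalFormula (.inr 0) p.const p.pos p.neg ⊔
      ((arbAtom _ p.ex ⊓ FirstOrder.Language.Formula.iExs _
          (arbAtom _ (fun n v => p.succ n (v ∘ .inl) (v ∘ .inr)) ⊓ (rounds t).relabel .inr)) ⊔
        (arbAtom _ p.all ⊓ FirstOrder.Language.Formula.iAlls _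
          ((arbAtom _ fun n v => p.succ n (v ∘ .inl) (v ∘ .inr)).imp ((rounds t).relabel .inr))))

theorem realize_rounds_succ {n : ℕ} (f : Fin n → Bool) (t : ℕ) (y : RecTuple i m (q + 1) n) :
    @FirstOrder.Language.Formula.Realize _ _ (wordStruct f).toStructure _ (p.rounds (t + 1)) y ↔
      p.Step f (@FirstOrder.Language.Formula.Realize _ _ (wordStruct f).toStructure _
        (p.rounds t)) y := by
  let _ := (wordStruct f).toStructure
  simp only [rounds, Step, FirstOrder.Language.Formula.realize_sup,
    FirstOrder.Language.Formula.realize_inf, FirstOrder.Language.Formula.realize_imp,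
    FirstOrder.Language.Formula.realize_iExs, FirstOrder.Language.Formula.realize_iAlls,
    FirstOrder.Language.Formula.realize_relabel, realize_literalFormula, realize_arbAtom]
  rfl

end Program

/-- For `i = 0` there is no block to halve, so the rounds, constant in number, are written out in
first-order logic; for `i ≥ 1` a single recursion evaluates the circuits. Words shorter than `2` are
added by a disjunct. -/
theorem circuitClass_subset {b : Mode} {i : ℕ} :
    circuitClass b i ⊆ definableOver wordVocabulary b i := by
  intro L hL
  obtain ⟨m, q, hm, p, D, hguard, htwo, hD, hp⟩ := exists_program hL
  suffices h : ∃ φ : GPRFormula wordVocabulary i 0, ∀ n (f : Fin n → Bool),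
      φ.Realize b (wordStruct f) Fin.elim0 ↔ 2 ≤ n ∧ List.ofFn f ∈ L by
    obtain ⟨φ, hφ⟩ := h
    refine mem_definableOver_word (.or (shortWords L i) φ) fun n f => ?_
    refine (or_congr (realize_shortWords b L i f) (hφ n f)).trans ?_
    rw [← or_and_right]
    exact and_iff_right (lt_or_ge n 2)
  rcases Nat.eq_zero_or_pos i with rfl | hi
  · refine ⟨.fo (FirstOrder.Language.Formula.iExs (RecVar 0 m (q + 1))
      ((arbAtom _ p.out ⊓ p.rounds (D 0)).relabel .inr)), fun n f => ?_⟩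
    let _ := (wordStruct f).toStructure
    rw [← hp n f (fun t => (p.rounds t).Realize) fun t y => p.realize_rounds_succ f t y, hD rfl n]
    change FirstOrder.Language.Formula.Realize _ _ ↔ _
    simp only [FirstOrder.Language.Formula.realize_iExs,
      FirstOrder.Language.Formula.realize_relabel, FirstOrder.Language.Formula.realize_inf,
      realize_arbAtom]
    rfl
  · refine ⟨.gpr 0 m (q + 1) hm p.body p.accept, fun n f => ?_⟩
    refine (Body.exists_defines_and b _ _ fun P => p.accept.Realize _ P _).trans ?_
    rw [Program.realize_accept]
    exact hp n f (fun _ => p.body.rel b (wordStruct f) Fin.elim0) fun _ y =>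
      (p.body.rel_defines b (wordStruct f) Fin.elim0 y).trans
        (p.realize_body (hguard hi) htwo f _ _ y)

theorem definableOver_word_eq {b : Mode} {i : ℕ} (hb : b = .bounded → 1 ≤ i) :
    definableOver wordVocabulary b i = circuitClass b i :=
  (definableOver_subset _ hb).antisymm circuitClass_subset

theorem exists_definableOver_eq {b : Mode} {i : ℕ} (hb : b = .bounded → 1 ≤ i) :
    {L | ∃ σ : Vocabulary, L ∈ definableOver σ b i} = circuitClass b i :=
  Set.Subset.antisymm (fun _ ⟨σ, hL⟩ => definableOver_subset σ hb hL)
    fun _ hL => ⟨_, circuitClass_subset hL⟩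

end CircuitLogic

theorem mainTheorem3 (i : ℕ) :
    (CircuitLogic.FOArbGPR i = CircuitLogic.AC i ∧
      CircuitLogic.definableOver CircuitLogic.wordVocabulary .unbounded i = CircuitLogic.AC i) ∧
    (1 ≤ i →
      CircuitLogic.FOArbGPRBound i = CircuitLogic.NC i ∧
      CircuitLogic.definableOver CircuitLogic.wordVocabulary .bounded i = CircuitLogic.NC i) := by
  rw [← CircuitLogic.circuitClass_unbounded, ← CircuitLogic.circuitClass_bounded]
  exact ⟨⟨CircuitLogic.exists_definableOver_eq nofun, CircuitLogic.definableOver_word_eq nofun⟩,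
    fun hi => ⟨CircuitLogic.exists_definableOver_eq fun _ => hi,
      CircuitLogic.definableOver_word_eq fun _ => hi⟩⟩
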